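/- **Setting.** Let $k,m,n$ be positive integers with $m\ge n$, let $D_{int}=\{(x,y)\in\mathbb Z^2: 0\le x\le n,\ 0\le y\le m\}$, and let $G$ be the grid graph on $D_{int}$ (adjacency = $\ell^1$-distance $1$). In the discrete covering path problem on the grid (D-CPPG) a *covering path* is a walk $P$ in $G$ together with a set $V_1\subseteq D_{int}$ of stops visited by $P$ such that every point of $D_{int}$ is within $\ell^1$-distance $k$ of a stop. Its path length $L$ is the number of edges of $P$ (with multiplicity), its stop count is $T=|V_1|$, and its cost is $\alpha L+\beta T$, where $\alpha,\beta\ge 0$. Put $N=mn$ and $p=2k^2+2k+1$. **Discrete up-and-down paths** on $[0,w]\times[0,m]$, of type $d\in\{1,2,4,\dots,2k,2k+1\}$. For $d\le 2k$ let $s=2k+1$ if $d=1$ and $s=2k+1-\frac d2$ otherwise; the path follows $(0,0)\to(0,m)\to(s,m)\to(s,0)\to(2s,0)\to(2s,m)\to\cdots$, the last traversal (vertical line) being $x=w$. On the traversals number $0,2,4,\dots$ the stops are at heights $0,d,2d,\dots\le m$; on the traversals number $1,3,5,\dots$ they are at heights $\frac d2,\frac{3d}2,\dots\le m$ (for $d=1$: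 on every traversal, at all heights $0,1,\dots,m$); in addition every traversal has a stop at height $m$. For $d=2k+1$ (zigzag path), take all $(a,b)\in\mathbb Z^2$ with $\frac{ka+(k+1)b}{p}\in\mathbb Z$ that lie within $\ell^1$-distance $k$ of an integer point of the rectangle, order them by the value $i=\frac{ka+(k+1)b}{p}$ and, for equal $i$, by $a$, with alternating direction from one nonempty class $i$ to the next; project each point onto the rectangle by clamping its coordinates, and connect the resulting stops in this order along shortest grid routes. **Mixed path** with average stop distance $d\in[1,2k+1]$. Let $f_{UB}(1)=2k+1$, $f_{UB}(j)=j(2k+1-\frac j2)$ for $j=2,4,\dots,2k$, and $f_{UB}(2k+1)=p$. Let $l<r$ be consecutive elements of $\{1,2,4,\dots,2k,2k+1\}$ with $l\le d<r$ (and $l=2k$, $r=2k+1$ if $d=2k+1$), and let $\gamma=\frac{f_{UB}(l)(r-d)}{f_{UB}(l)(r-d)+f_{UB}(r)(d-l)}$. Equivalently, $(L_1,T_1)=\gamma\left(\frac{lN}{f_{UB}(l)},\frac{N}{f_{UB}(l)}\right)+(1-\gamma)\left(\frac{rN}{f_{UB}(r)},\frac{N}{f_{UB}(r)}\right)$ satisfies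 $L_1/T_1=d$. With $w=\lceil\gamma n\rceil$, the mixed path is the type-$l$ path on $[0,w]\times[0,m]$ followed, via a shortest connection, by the type-$r$ path on $[w,n]\times[0,m]$ (a part of width $0$ is omitted). **Relaxation.** Let $f_{LB}:[1,\infty)\to\mathbb R$ be the piecewise linear interpolation of the values $f_{LB}(j)=j(2k+1-\frac j2)+\frac12$ for odd $j\le 2k$, $f_{LB}(j)=j(2k+1-\frac j2)$ for even $j\le 2k$, and $f_{LB}(j)=p$ for integers $j\ge 2k+1$. The relaxed problem is to minimize $\alpha L+\beta T$ over all real $(L,T)$ with $T>1$, $\frac{L}{T-1}\ge1$ and $(T-1)f_{LB}\left(\frac{L}{T-1}\right)=N-p$. **Theorem.** There are absolute constants $C,C'>0$ such that the following holds for all integers $k\ge1$, all $\varepsilon\in(0,1)$, all integers $m\ge n\ge Ck/\varepsilon$ and all $\alpha,\beta\ge0$. The relaxed problem has a minimizer, and for every minimizer $(L^*,T^*)$ the mixed discrete up-and-down path with average stop distance $d=\min\left\{\frac{L^*}{T^*-1},\,2k+1\right\}$ is a covering path whose cost is at most $\left(\frac{11}{10}+C'\varepsilon\right)$ times the cost of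 every covering path. That is, it is a $\left(\frac{11}{10}+O(\varepsilon)\right)$-approximation for the D-CPPG with cost $\alpha L+\beta T$. -/

import Mathlib

/-- The `ℓ¹` distance between integer points of the plane. -/
def l1Dist (u v : ℤ × ℤ) : ℤ := |u.1 - v.1| + |u.2 - v.2|

/-- The integer points `(x, y)` with `0 ≤ x ≤ n` and `0 ≤ y ≤ m`. -/
noncomputable def gridPoints (n m : ℕ) : Finset (ℤ × ℤ) :=
  Finset.Icc (0 : ℤ) n ×ˢ Finset.Icc (0 : ℤ) m

/-- The unit grid: two points of `gridPoints n m` are adjacent iff they are at distance `1`.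
(Integer points outside the rectangle are isolated vertices.) -/
def gridGraph (n m : ℕ) : SimpleGraph (ℤ × ℤ) where
  Adj u v := u ∈ gridPoints n m ∧ v ∈ gridPoints n m ∧ l1Dist u v = 1
  symm := ⟨fun u v h => ⟨h.2.1, h.1, by
    have h3 := h.2.2
    simp only [l1Dist] at h3 ⊢
    rwa [abs_sub_comm v.1, abs_sub_comm v.2]⟩⟩
  loopless := ⟨fun u h => by simpa [l1Dist] using h.2.2⟩

/-- `P` together with the set of stops `S` is a covering path for the discrete problem:
all stops are grid points, `P` visits all stops, and every grid point is within
distance `k` of a stop. -/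
def IsCoveringPath (k n m : ℕ) {u v : ℤ × ℤ} (P : (gridGraph n m).Walk u v)
    (S : Finset (ℤ × ℤ)) : Prop :=
  S ⊆ gridPoints n m ∧ (∀ s ∈ S, s ∈ P.support) ∧
    ∀ z ∈ gridPoints n m, ∃ s ∈ S, l1Dist s z ≤ k

/-- The cost `α L + β T`, where `L` is the path length and `T` the number of stops. -/
noncomputable def pathCost (α β : ℝ) {n m : ℕ} {u v : ℤ × ℤ} (P : (gridGraph n m).Walk u v)
    (S : Finset (ℤ × ℤ)) : ℝ :=
  α * (P.length : ℝ) + β * (S.card : ℝ)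

/-- `P` goes through the points of the list in the given order, along a shortest grid route
between any two consecutive ones. -/
inductive FollowsRoute (n m : ℕ) :
    List (ℤ × ℤ) → ∀ {u v : ℤ × ℤ}, (gridGraph n m).Walk u v → Prop
  | single (u : ℤ × ℤ) : FollowsRoute n m [u] (SimpleGraph.Walk.nil : (gridGraph n m).Walk u u)
  | cons {u x v : ℤ × ℤ} {l : List (ℤ × ℤ)} (p : (gridGraph n m).Walk u x)
      (q : (gridGraph n m).Walk x v) (hp : (p.length : ℤ) = l1Dist u x)
      (hq : FollowsRoute n m (x :: l) q) : FollowsRoute n m (u :: x :: l) (p.append q)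

/-- A path plan: the points that the path connects one after the other, and the set of stops. -/
structure PathPlan where
  waypoints : List (ℤ × ℤ)
  stops : Finset (ℤ × ℤ)

/-- Translation of a plan by `(w, 0)`. -/
def PathPlan.shift (A : PathPlan) (w : ℕ) : PathPlan where
  waypoints := A.waypoints.map fun z => (z.1 + w, z.2)
  stops := A.stops.image fun z => (z.1 + w, z.2)

/-- First follow `A`, then go to the first point of `B` and follow `B`. -/
def PathPlan.append (A B : PathPlan) : PathPlan where
  waypoints := A.waypoints ++ B.waypoints
  stops := A.stops ∪ B.stops

/-- Separation of consecutive traversals in a type-`d` up-and-down path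
(`d = 1`, or `d` even with `2 ≤ d ≤ 2k`). -/
def separation (k d : ℕ) : ℕ := if d = 1 then 2 * k + 1 else 2 * k + 1 - d / 2

/-- Abscissa of traversal `i` on the rectangle of width `w`; the rightmost traversal is `x = w`. -/
def traversalX (k d w i : ℕ) : ℕ := min (i * separation k d) w

/-- Number of traversals: `⌈w / separation⌉ + 1`. -/
def traversalCount (k d w : ℕ) : ℕ := (w + separation k d - 1) / separation k d + 1

/-- The type-`d` discrete up-and-down path, `d ∈ {1, 2, 4, …, 2k}`, on `gridPoints w m`:
`(0,0) → (0,m) → (s,m) → (s,0) → (2s,0) → (2s,m) → ⋯` with `s` the separation.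
The traversals number `0, 2, 4, …` have stops at the heights `0, d, 2d, …`, the traversals number
`1, 3, 5, …` have stops at the heights `d/2, d/2 + d, …`, and every traversal has a stop at
height `m`. For `d = 1` (where `d / 2 = 0` in `ℕ`) every integer point of a traversal is a stop. -/
noncomputable def upDownPlan (k d w m : ℕ) : PathPlan where
  waypoints := (List.range (traversalCount k d w)).flatMap fun i =>
    if Even i then [((traversalX k d w i : ℤ), 0), ((traversalX k d w i : ℤ), (m : ℤ))]
    else [((traversalX k d w i : ℤ), (m : ℤ)), ((traversalX k d w i : ℤ), 0)]
  stops := (Finset.range (traversalCount k d w)).biUnion fun i =>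
    ((Finset.range (m + 1)).filter fun y =>
        y % d = (if Even i then 0 else d / 2) ∨ y = m).image
      fun y : ℕ => ((traversalX k d w i : ℤ), (y : ℤ))

/-- The number `2k² + 2k + 1` of integer points within distance `k` of an integer point. -/
def ballSize (k : ℕ) : ℕ := 2 * k ^ 2 + 2 * k + 1

/-- The linear form whose multiples of `ballSize k` define the tessellation `𝔸`. -/
def tessForm (k : ℕ) (z : ℤ × ℤ) : ℤ := k * z.1 + (k + 1) * z.2

/-- The points of the tessellation `𝔸 = {z | ballSize k ∣ tessForm k z}` whose ball of radius `k`
contains a point of `gridPoints w m` (such points lie in `[-k, w + k] × [-k, m + k]`). -/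
noncomputable def tessPoints (k w m : ℕ) : Finset (ℤ × ℤ) :=
  (Finset.Icc (-(k : ℤ)) (w + k) ×ˢ Finset.Icc (-(k : ℤ)) (m + k)).filter fun z =>
    (ballSize k : ℤ) ∣ tessForm k z ∧ ∃ x ∈ gridPoints w m, l1Dist z x ≤ k

/-- The rotated traversal number `i`: the chosen points with `tessForm k z = i * ballSize k`,
listed by increasing abscissa (the abscissa `a` determines the point). -/
noncomputable def tessTraversal (k w m : ℕ) (i : ℤ) : List (ℤ × ℤ) :=
  ((((tessPoints k w m).filter fun z => tessForm k z = i * ballSize k).image Prod.fst).sort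
    (· ≤ ·)).map fun a => (a, (i * ballSize k - k * a) / (k + 1))

/-- The numbers of the nonempty rotated traversals, in increasing order. -/
noncomputable def tessIndices (k w m : ℕ) : List ℤ :=
  ((tessPoints k w m).image fun z => tessForm k z / ballSize k).sort (· ≤ ·)

/-- Projection of an integer point onto the rectangle `[0, w] × [0, m]`. -/
noncomputable def projectGrid (w m : ℕ) (z : ℤ × ℤ) : ℤ × ℤ :=
  (max 0 (min z.1 w), max 0 (min z.2 m))

/-- The stops of the zigzag path in their order of visit: the rotated traversals are run through
in alternating directions, and stops outside the rectangle are projected onto it. -/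
noncomputable def zigzagList (k w m : ℕ) : List (ℤ × ℤ) :=
  (((tessIndices k w m).mapIdx fun j i =>
    if Even j then tessTraversal k w m i else (tessTraversal k w m i).reverse).flatten).map
    (projectGrid w m)

/-- The type-`(2k+1)` discrete up-and-down path (zigzag path) on `gridPoints w m`. -/
noncomputable def zigzagPlan (k w m : ℕ) : PathPlan where
  waypoints := zigzagList k w m
  stops := (zigzagList k w m).toFinset

/-- The type-`d` discrete up-and-down path, `d ∈ {1, 2, 4, …, 2k, 2k+1}`, on `gridPoints w m`. -/
noncomputable def discretePlan (k d w m : ℕ) : PathPlan :=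
  if d = 2 * k + 1 then zigzagPlan k w m else upDownPlan k d w m

/-- Mixed path on `gridPoints n m`: type `l` on `[0, w] × [0, m]`, then type `r` on
`[w, n] × [0, m]`. A part of width zero is left out, since the other part covers everything. -/
noncomputable def mixedPlanAt (k n m l r w : ℕ) : PathPlan :=
  if w = 0 then discretePlan k r n m
  else if n ≤ w then discretePlan k l n m
  else (discretePlan k l w m).append ((discretePlan k r (n - w) m).shift w)

/-- `f_LB` at positive integers. -/
noncomputable def fLBNat (k t : ℕ) : ℝ :=
  if t ≤ 2 * k then
    if Odd t then (t : ℝ) * (2 * k + 1 - t / 2) + 1 / 2 else (t : ℝ) * (2 * k + 1 - t / 2)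
  else 2 * k ^ 2 + 2 * k + 1

/-- `f_LB` on `[1, ∞)`: the piecewise linear interpolation of `fLBNat`. -/
noncomputable def fLB (k : ℕ) (d : ℝ) : ℝ :=
  (⌊d⌋₊ + 1 - d) * fLBNat k ⌊d⌋₊ + (d - ⌊d⌋₊) * fLBNat k (⌊d⌋₊ + 1)

/-- `f_UB` at its turning points `1, 2, 4, …, 2k, 2k+1`. -/
noncomputable def fUB (k d : ℕ) : ℝ :=
  if d = 1 then 2 * k + 1
  else if d ≤ 2 * k then (d : ℝ) * (2 * k + 1 - d / 2)
  else 2 * k ^ 2 + 2 * k + 1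

/-- The boundary `(T - 1) f_LB(L / (T - 1)) = N - (2k² + 2k + 1)`, `N = mn`, of the trade-off
constraint, in the `(L, T)`-plane. -/
def lowerBoundary (k n m : ℕ) : Set (ℝ × ℝ) :=
  {q | 1 < q.2 ∧ 1 ≤ q.1 / (q.2 - 1) ∧
    (q.2 - 1) * fLB k (q.1 / (q.2 - 1)) = (m : ℝ) * n - (2 * k ^ 2 + 2 * k + 1)}

/-- `q = (L*, T*)` minimizes `α L + β T` over the boundary of the trade-off constraint. -/
def IsRelaxedOptimum (k n m : ℕ) (α β : ℝ) (q : ℝ × ℝ) : Prop :=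
  q ∈ lowerBoundary k n m ∧ ∀ q' ∈ lowerBoundary k n m, α * q.1 + β * q.2 ≤ α * q'.1 + β * q'.2

/-- The average distance between consecutive stops `L / (T - 1)`, capped at `2k + 1`. -/
noncomputable def targetSpacing (k : ℕ) (q : ℝ × ℝ) : ℝ := min (q.1 / (q.2 - 1)) (2 * k + 1)

/-- For `1 ≤ d ≤ 2k+1`: the left end of an interval between consecutive path types
`1, 2, 4, …, 2k, 2k+1` that contains `d`. -/
noncomputable def lowerType (d : ℝ) : ℕ := if d < 2 then 1 else 2 * ⌊d / 2⌋₊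

/-- The path type that follows type `l` in `1, 2, 4, …, 2k, 2k+1`. -/
def nextType (k l : ℕ) : ℕ := if l = 1 then 2 else min (l + 2) (2 * k + 1)

/-- The weight `γ` for which `γ (l/f(l), 1/f(l)) + (1-γ) (r/f(r), 1/f(r))`, `f = f_UB`, has ratio
of coordinates `d`: this is the point with average distance `d` on the upper polyline
(up to the factor `N`). -/
noncomputable def mixWeight (k l r : ℕ) (d : ℝ) : ℝ :=
  fUB k l * (r - d) / (fUB k l * (r - d) + fUB k r * (d - l))

/-- The mixed discrete up-and-down path with average stop distance `d`, `1 ≤ d ≤ 2k + 1`. -/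
noncomputable def mixedPlan (k n m : ℕ) (d : ℝ) : PathPlan :=
  mixedPlanAt k n m (lowerType d) (nextType k (lowerType d))
    ⌈mixWeight k (lowerType d) (nextType k (lowerType d)) d * n⌉₊

/-!
**Lower bound.** Order the stops of a covering path by their first visits. A stop at distance `t`
from another one covers at most `fLBNat k t` points that the other one does not
(`card_l1Ball_sdiff_le`): the intersection of the two balls contains a ball around a midpoint, or
the intersection of two balls around neighbouring near-midpoints if `t` is odd. Since `fLBNat k`
is concave (`fLBNat_le_line`), the average distance `L / (T - 1)` satisfies the trade-off `(T - 1)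
f_LB(L / (T - 1)) ≥ N - p` (`tradeoff`), where `N = m n` and `p = ballSize k`. The left side is
homogeneous of degree one in `(L, T - 1)`, so scaling down to equality shows that the relaxed
minimum is a lower bound for the cost (`relaxed_le_pathCost`). It is attained because `f_LB` is
piecewise linear and constant from `2k + 1` on (`exists_isRelaxedOptimum`).

**Covering.** In an up-and-down path of type `d = 2h`, a point between two consecutive traversals
is covered from one of them, because its vertical distances to the stops of the one and of the
other add up to at most `h`, and the traversals are at most `2k + 1 - h` apart. For the zigzag
path, the linear form `tessForm k` is injective modulo `p` on every ball of radius `k`, which has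
`p` points, so every integer point is within `k` of a point of the tessellation
(`exists_tess_near`); clamping to the rectangle does not increase distances to points inside.

**Upper bound.** A path of type `t` on a strip of width `w` has length at most `w m t / f_UB(t) +
O(m)` and at most `w m / f_UB(t) + O(m / t)` stops (`discretePlan_bounds`). For the zigzag path,
the disjointness of the balls bounds the number of stops, consecutive stops of a rotated traversal
are `2k + 1` apart, and the connections between rotated traversals telescope: their endpoints lie
near two adjacent sides of the rectangle, along which `tessForm k` is monotone with slope at least
`k` (`tessTraversal_last_dist`, `tessTraversal_head_dist`, `routeLen_alternating_le`). Hence, with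
`D` the linear interpolation of `f_UB` at `d`, the mixed path has length `(1 + O(ε)) d N / D` and
`(1 + O(ε)) N / D` stops (`mixedPlan_bounds`), whichever `d` is chosen.

**Comparison.** The functions `f_LB` and `f_UB` agree at `1, 2, 4, …, 2k, 2k + 1`, and at odd
distances in between `f_LB` exceeds the interpolation of `f_UB` by `1`. As the interpolation is at
least `10` there, with equality for `k = 2` at `3`, `f_LB ≤ (11/10) D` holds throughout
(`fLB_mul_le`). So both the length and the number of stops of the mixed path are at most `11/10 +
O(ε)` times those of the relaxed optimum.
-/

/-! ### Balls for the `ℓ¹` distance -/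

theorem l1Dist_comm (u v : ℤ × ℤ) : l1Dist u v = l1Dist v u := by
  simp only [l1Dist, abs_sub_comm]

theorem l1Dist_nonneg (u v : ℤ × ℤ) : 0 ≤ l1Dist u v := by
  unfold l1Dist; positivity

theorem l1Dist_self (u : ℤ × ℤ) : l1Dist u u = 0 := by simp [l1Dist]

theorem l1Dist_triangle (u v w : ℤ × ℤ) : l1Dist u w ≤ l1Dist u v + l1Dist v w := by
  simp only [l1Dist, abs_eq_max_neg]; omega

theorem l1Dist_eq_zero {u v : ℤ × ℤ} (h : l1Dist u v = 0) : u = v := by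
  simp only [l1Dist, abs_eq_max_neg] at h
  ext <;> omega

/-- The ball of radius `r` around `c` for the `ℓ¹` distance on integer points. -/
noncomputable def l1Ball (r : ℕ) (c : ℤ × ℤ) : Finset (ℤ × ℤ) :=
  (Finset.Icc (c.1 - r) (c.1 + r) ×ˢ Finset.Icc (c.2 - r) (c.2 + r)).filter
    fun z => l1Dist c z ≤ r

theorem mem_l1Ball {r : ℕ} {c z : ℤ × ℤ} : z ∈ l1Ball r c ↔ l1Dist c z ≤ r := by
  rw [l1Ball, Finset.mem_filter, Finset.mem_product, Finset.mem_Icc, Finset.mem_Icc]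
  simp only [l1Dist, abs_eq_max_neg]
  omega

theorem sum_Icc_l1Ball (r : ℕ) :
    ∑ a ∈ Finset.Icc (-(r : ℤ)) r, (2 * (r - |a|) + 1) = (ballSize r : ℤ) := by
  induction r with
  | zero => simp [ballSize]
  | succ r ih =>
    have h1 : Finset.Icc (-((r + 1 : ℕ) : ℤ)) ((r + 1 : ℕ) : ℤ) =
        insert (-((r : ℤ) + 1)) (insert ((r : ℤ) + 1) (Finset.Icc (-(r : ℤ)) r)) := by
      ext a
      simp only [Finset.mem_Icc, Finset.mem_insert]
      omega
    rw [h1, Finset.sum_insert, Finset.sum_insert]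
    · have h2 : ∑ a ∈ Finset.Icc (-(r : ℤ)) r, (2 * (((r + 1 : ℕ) : ℤ) - |a|) + 1) =
          ∑ a ∈ Finset.Icc (-(r : ℤ)) r, ((2 * (r - |a|) + 1) + 2) := by
        refine Finset.sum_congr rfl fun a _ => ?_
        push_cast; ring
      rw [h2, Finset.sum_add_distrib, ih, abs_neg, abs_of_nonneg (by positivity)]
      simp only [Finset.sum_const, Int.card_Icc, ballSize, nsmul_eq_mul]
      have h3 : (((r : ℤ) + 1 - -(r : ℤ)).toNat : ℤ) = 2 * r + 1 := by omega
      rw [h3]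
      push_cast; ring
    · simp
    · simp only [Finset.mem_Icc, Finset.mem_insert]
      omega

theorem card_l1Ball (r : ℕ) (c : ℤ × ℤ) : (l1Ball r c).card = ballSize r := by
  have h := Finset.card_eq_sum_card_fiberwise (s := l1Ball r c)
    (t := Finset.Icc (-(r : ℤ)) r) (f := fun z => z.1 - c.1) (by
      intro z hz
      have hz := mem_l1Ball.1 hz
      simp only [l1Dist, abs_eq_max_neg] at hz
      simp only [Finset.coe_Icc, Set.mem_Icc]
      omega)
  rw [h]
  zify
  rw [← sum_Icc_l1Ball]
  refine Finset.sum_congr rfl fun a ha => ?_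
  have h2 : (l1Ball r c).filter (fun z => z.1 - c.1 = a) =
      (Finset.Icc (c.2 - (r - |a|)) (c.2 + (r - |a|))).image fun b => (c.1 + a, b) := by
    ext ⟨x, y⟩
    simp only [Finset.mem_filter, mem_l1Ball, Finset.mem_image, Finset.mem_Icc, l1Dist,
      Prod.mk.injEq, abs_eq_max_neg]
    constructor
    · rintro ⟨h3, h4⟩
      exact ⟨y, by omega, by omega, rfl⟩
    · rintro ⟨b, h3, h4, rfl⟩
      omega
  rw [h2, Finset.card_image_of_injective _ (fun b b' hb => by simpa using hb), Int.card_Icc]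
  simp only [Finset.mem_Icc] at ha
  rw [abs_eq_max_neg]
  omega

theorem l1Ball_subset {r r' : ℕ} {c c' : ℤ × ℤ} (h : l1Dist c' c + r ≤ r') :
    l1Ball r c ⊆ l1Ball r' c' := by
  intro z hz
  rw [mem_l1Ball] at hz ⊢
  linarith [l1Dist_triangle c' c z]

/-- The far side of a ball, as seen from a neighbour of its centre, has at most one point in each
line parallel to the direction of the neighbour. -/
theorem card_l1Ball_sdiff_of_adjacent (r : ℕ) {c c' : ℤ × ℤ} (h : l1Dist c c' = 1) :
    (l1Ball r c \ l1Ball r c').card ≤ 2 * r + 1 := by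
  have hcard : (Finset.Icc (-(r : ℤ)) r).card = 2 * r + 1 := by
    rw [Int.card_Icc]; omega
  rw [← hcard]
  rcases eq_or_ne c.2 c'.2 with h2 | h2
  · refine Finset.card_le_card_of_injOn (fun z => z.2 - c.2) ?_ ?_
    · intro z hz
      simp only [Finset.coe_sdiff, Set.mem_sdiff, Finset.mem_coe, mem_l1Ball, l1Dist,
        abs_eq_max_neg] at hz
      simp only [Finset.coe_Icc, Set.mem_Icc]
      omega
    · intro z hz z' hz' hzz
      simp only [Finset.coe_sdiff, Set.mem_sdiff, Finset.mem_coe, mem_l1Ball, l1Dist,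
        abs_eq_max_neg] at hz hz' h hzz
      ext <;> omega
  · refine Finset.card_le_card_of_injOn (fun z => z.1 - c.1) ?_ ?_
    · intro z hz
      simp only [Finset.coe_sdiff, Set.mem_sdiff, Finset.mem_coe, mem_l1Ball, l1Dist,
        abs_eq_max_neg] at hz
      simp only [Finset.coe_Icc, Set.mem_Icc]
      omega
    · intro z hz z' hz' hzz
      simp only [Finset.coe_sdiff, Set.mem_sdiff, Finset.mem_coe, mem_l1Ball, l1Dist,
        abs_eq_max_neg] at hz hz' h hzz
      ext <;> omega

/-- Every distance up to `l1Dist u v` is attained on a shortest route from `u` to `v`. -/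
theorem exists_l1Dist_eq (u v : ℤ × ℤ) (a : ℤ) (ha : 0 ≤ a) (hb : a ≤ l1Dist u v) :
    ∃ c, l1Dist u c = a ∧ l1Dist c v = l1Dist u v - a := by
  simp only [l1Dist, abs_eq_max_neg] at hb ⊢
  rcases le_total u.1 v.1 with h1 | h1 <;> rcases le_total u.2 v.2 with h2 | h2 <;>
    rcases le_total a |u.1 - v.1| with h3 | h3 <;> simp only [abs_eq_max_neg] at h3
  · exact ⟨(u.1 + a, u.2), by simp only; omega, by simp only; omega⟩
  · exact ⟨(v.1, u.2 + (a - (v.1 - u.1))), by simp only; omega, by simp only; omega⟩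
  · exact ⟨(u.1 + a, u.2), by simp only; omega, by simp only; omega⟩
  · exact ⟨(v.1, u.2 - (a - (v.1 - u.1))), by simp only; omega, by simp only; omega⟩
  · exact ⟨(u.1 - a, u.2), by simp only; omega, by simp only; omega⟩
  · exact ⟨(v.1, u.2 + (a - (u.1 - v.1))), by simp only; omega, by simp only; omega⟩
  · exact ⟨(u.1 - a, u.2), by simp only; omega, by simp only; omega⟩
  · exact ⟨(v.1, u.2 - (a - (u.1 - v.1))), by simp only; omega, by simp only; omega⟩

/-- A stop at distance `t` from another one covers at most `fLBNat k t` further points. -/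
theorem card_l1Ball_sdiff_le (k t : ℕ) {u v : ℤ × ℤ} (h : l1Dist u v = t) :
    ((l1Ball k u \ l1Ball k v).card : ℝ) ≤ fLBNat k t := by
  have hsub : ∀ X : Finset (ℤ × ℤ), X ⊆ l1Ball k u ∩ l1Ball k v →
      ((l1Ball k u \ l1Ball k v).card : ℝ) ≤ ballSize k - X.card := by
    intro X hX
    have h1 := Finset.card_sdiff_add_card_inter (l1Ball k u) (l1Ball k v)
    have h2 := Finset.card_le_card hX
    rw [card_l1Ball] at h1
    have h3 : (l1Ball k u \ l1Ball k v).card + X.card ≤ ballSize k := by omega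
    have h4 : ((l1Ball k u \ l1Ball k v).card : ℝ) + X.card ≤ ballSize k := by exact_mod_cast h3
    linarith
  unfold fLBNat
  by_cases ht : t ≤ 2 * k
  · rw [if_pos ht]
    rcases Nat.even_or_odd' t with ⟨a, rfl | rfl⟩
    · rw [if_neg (by simp)]
      obtain ⟨c, hc1, hc2⟩ := exists_l1Dist_eq u v a (by positivity) (by rw [h]; push_cast; omega)
      have hc3 : l1Dist v c = a := by rw [l1Dist_comm, hc2, h]; push_cast; ring
      obtain ⟨b, rfl⟩ := Nat.exists_eq_add_of_le (show a ≤ k by omega)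
      have h1 := hsub (l1Ball b c) (Finset.subset_inter
        (l1Ball_subset (by rw [hc1]; push_cast; omega))
        (l1Ball_subset (by rw [hc3]; push_cast; omega)))
      refine h1.trans (le_of_eq ?_)
      rw [card_l1Ball]
      simp only [ballSize]
      push_cast; ring
    · rw [if_pos (by simp)]
      obtain ⟨c, hc1, hc2⟩ := exists_l1Dist_eq u v a (by positivity) (by rw [h]; push_cast; omega)
      rw [h] at hc2
      obtain ⟨c', hc3, hc4⟩ := exists_l1Dist_eq c v 1 (by positivity)
        (by rw [hc2]; push_cast; omega)
      have hc5 : l1Dist v c' = a := by rw [l1Dist_comm, hc4, hc2]; push_cast; ring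
      obtain ⟨b, rfl⟩ := Nat.exists_eq_add_of_le (show a ≤ k by omega)
      have h1 := hsub (l1Ball b c ∩ l1Ball b c') (Finset.inter_subset_inter
        (l1Ball_subset (by rw [hc1]; push_cast; omega))
        (l1Ball_subset (by rw [hc5]; push_cast; omega)))
      refine h1.trans ?_
      have h2 := Finset.card_sdiff_add_card_inter (l1Ball b c) (l1Ball b c')
      have h3 := card_l1Ball_sdiff_of_adjacent b hc3
      rw [card_l1Ball] at h2
      have h4 : (ballSize b : ℝ) ≤ 2 * b + 1 + (l1Ball b c ∩ l1Ball b c').card := by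
        have : ballSize b ≤ 2 * b + 1 + (l1Ball b c ∩ l1Ball b c').card := by omega
        exact_mod_cast this
      simp only [ballSize] at h4 ⊢
      push_cast at h4 ⊢
      nlinarith
  · rw [if_neg ht]
    refine (hsub ∅ (Finset.empty_subset _)).trans (le_of_eq ?_)
    simp [ballSize]

/-! ### Length and number of stops of a covering path -/

/-- Length of the route through the points of a list. -/
def routeLen : List (ℤ × ℤ) → ℤ
  | [] => 0
  | [_] => 0
  | x :: y :: l => l1Dist x y + routeLen (y :: l)

theorem routeLen_nonneg : ∀ l : List (ℤ × ℤ), 0 ≤ routeLen l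
  | [] => le_rfl
  | [_] => le_rfl
  | x :: y :: l => add_nonneg (l1Dist_nonneg x y) (routeLen_nonneg (y :: l))

theorem routeLen_le_cons (a : ℤ × ℤ) : ∀ l : List (ℤ × ℤ), routeLen l ≤ routeLen (a :: l)
  | [] => le_rfl
  | x :: l => by
    have := l1Dist_nonneg a x
    simp only [routeLen]; linarith

theorem routeLen_cons_le (a b : ℤ × ℤ) :
    ∀ l : List (ℤ × ℤ), routeLen (a :: l) ≤ l1Dist a b + routeLen (b :: l)
  | [] => by simpa [routeLen] using l1Dist_nonneg a b
  | x :: l => by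
    have := l1Dist_triangle a b x
    simp only [routeLen]; linarith

theorem routeLen_cons_sublist {l l' : List (ℤ × ℤ)} (h : l.Sublist l') :
    ∀ a, routeLen (a :: l) ≤ routeLen (a :: l') := by
  induction h with
  | slnil => exact fun a => le_rfl
  | cons b _ ih =>
    intro a
    refine (routeLen_cons_le a b _).trans ?_
    simpa [routeLen] using ih b
  | cons_cons b _ ih =>
    intro a
    simpa [routeLen] using ih b

theorem routeLen_support {n m : ℕ} {u v : ℤ × ℤ} (P : (gridGraph n m).Walk u v) :
    routeLen P.support = P.length := by
  induction P with
  | nil => simp [routeLen]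
  | @cons u v w h p ih =>
    have h2 : l1Dist u v = 1 := h.2.2
    rw [SimpleGraph.Walk.support_cons, ← p.cons_tail_support, routeLen, p.cons_tail_support, ih, h2,
      SimpleGraph.Walk.length_cons]
    push_cast; ring

theorem routeLen_le_length {n m : ℕ} {u v : ℤ × ℤ} (P : (gridGraph n m).Walk u v)
    {l : List (ℤ × ℤ)} (hl : l.Sublist P.support) : routeLen l ≤ P.length := by
  have h := routeLen_cons_sublist hl u
  rw [← routeLen_support]
  refine (routeLen_le_cons u l).trans (h.trans ?_)
  rw [← P.cons_tail_support]
  simp [routeLen, l1Dist_self]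

/-- The increment of `fLBNat k` from `t` to `t + 1` (with truncated subtraction). -/
def fLBStep (k t : ℕ) : ℕ := if Even t then 2 * k + 1 - t else 2 * k - t

theorem fLBStep_antitone (k : ℕ) : Antitone (fLBStep k) := by
  refine antitone_nat_of_succ_le fun t => ?_
  simp only [fLBStep, Nat.even_iff]
  split_ifs <;> omega

theorem fLBNat_succ (k t : ℕ) : fLBNat k (t + 1) = fLBNat k t + fLBStep k t := by
  simp only [fLBNat, fLBStep]
  rcases Nat.even_or_odd' t with ⟨a, rfl | rfl⟩
  · have h1 : Even (2 * a) := by simp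
    have h2 : Odd (2 * a + 1) := by simp
    have h3 : ¬ Odd (2 * a) := by simp
    simp only [h1, h2, h3, if_true, if_false]
    rcases lt_trichotomy a k with h | rfl | h
    · rw [if_pos (by omega), if_pos (by omega), Nat.cast_sub (by omega)]
      push_cast; ring
    · rw [if_neg (by omega), if_pos (by omega), Nat.cast_sub (by omega)]
      push_cast; ring
    · rw [if_neg (by omega), if_neg (by omega), Nat.sub_eq_zero_of_le (by omega)]
      simp
  · have h1 : ¬ Even (2 * a + 1) := by simp
    have h2 : Odd (2 * a + 1) := by simp
    have h3 : ¬ Odd (2 * a + 1 + 1) := by simp [Nat.even_add_one]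
    simp only [h1, h2, h3, if_true, if_false]
    by_cases h : a + 1 ≤ k
    · rw [if_pos (by omega), if_pos (by omega), Nat.cast_sub (by omega)]
      push_cast; ring
    · rw [if_neg (by omega), if_neg (by omega), Nat.sub_eq_zero_of_le (by omega)]
      simp

/-- Concavity of `fLBNat k`: the line through the points at `j` and `j + 1` is a supporting line. -/
theorem fLBNat_le_line (k j t : ℕ) :
    fLBNat k t ≤ fLBNat k j + ((t : ℝ) - j) * fLBStep k j := by
  rcases le_total j t with h | h
  · obtain ⟨i, rfl⟩ := Nat.exists_eq_add_of_le h
    clear h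
    induction i with
    | zero => simp
    | succ i ih =>
      have h1 : (fLBStep k (j + i) : ℝ) ≤ fLBStep k j := by
        exact_mod_cast fLBStep_antitone k (Nat.le_add_right j i)
      rw [← add_assoc, fLBNat_succ]
      push_cast at ih ⊢
      linarith
  · obtain ⟨i, rfl⟩ := Nat.exists_eq_add_of_le h
    clear h
    induction i with
    | zero => simp
    | succ i ih =>
      have h1 : (fLBStep k (t + i + 1) : ℝ) ≤ fLBStep k (t + i) := by
        exact_mod_cast fLBStep_antitone k (Nat.le_succ (t + i))
      rw [← add_assoc, fLBNat_succ]
      push_cast at ih ⊢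
      nlinarith [(Nat.cast_nonneg i : (0 : ℝ) ≤ i)]

theorem fLB_eq (k : ℕ) (d : ℝ) :
    fLB k d = fLBNat k ⌊d⌋₊ + (d - ⌊d⌋₊) * fLBStep k ⌊d⌋₊ := by
  rw [fLB, fLBNat_succ]; ring

theorem fLBNat_mono (k : ℕ) : Monotone (fLBNat k) :=
  monotone_nat_of_le_succ fun t => by rw [fLBNat_succ]; simp

theorem fLBNat_one (k : ℕ) : fLBNat k 1 = 2 * k + 1 := by
  rw [fLBNat_succ k 0]
  simp [fLBNat, fLBStep]

theorem one_le_fLB (k : ℕ) {d : ℝ} (hd : 1 ≤ d) : 1 ≤ fLB k d := by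
  have h1 : 1 ≤ ⌊d⌋₊ := (Nat.one_le_floor_iff d).2 hd
  have h2 := fLBNat_mono k h1
  rw [fLBNat_one] at h2
  have h3 : (0 : ℝ) ≤ (d - ⌊d⌋₊) * fLBStep k ⌊d⌋₊ :=
    mul_nonneg (sub_nonneg.2 (Nat.floor_le (by linarith))) (by positivity)
  rw [fLB_eq]
  have : (0 : ℝ) ≤ k := by positivity
  linarith

theorem fLBNat_of_lt {k t : ℕ} (h : 2 * k < t) : fLBNat k t = ballSize k := by
  simp [fLBNat, ballSize, Nat.not_le.2 h]

theorem fLB_of_le {k : ℕ} {d : ℝ} (h : 2 * k + 1 ≤ d) : fLB k d = ballSize k := by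
  have h1 : 2 * k + 1 ≤ ⌊d⌋₊ := Nat.le_floor (by exact_mod_cast h)
  rw [fLB, fLBNat_of_lt (by omega), fLBNat_of_lt (by omega)]
  ring

/-- The stops of a list, each covering only what its successor does not, bounded by a line
that dominates `fLBNat`. -/
theorem card_cover_le (k : ℕ) (A B : ℝ) (hAB : ∀ t : ℕ, fLBNat k t ≤ A + B * t) :
    ∀ l : List (ℤ × ℤ), l ≠ [] → ((l.toFinset.biUnion (l1Ball k)).card : ℝ) ≤
      ballSize k + A * (l.length - 1) + B * routeLen l
  | [], h => absurd rfl h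
  | [x], _ => by simp [card_l1Ball, routeLen]
  | x :: y :: l, _ => by
    have ih := card_cover_le k A B hAB (y :: l) (by simp)
    have h1 : ((x :: y :: l).toFinset.biUnion (l1Ball k)) ⊆
        (l1Ball k x \ l1Ball k y) ∪ ((y :: l).toFinset.biUnion (l1Ball k)) := by
      intro z
      simp only [List.toFinset_cons, Finset.biUnion_insert, Finset.mem_union, Finset.mem_sdiff]
      tauto
    have h2 : (((x :: y :: l).toFinset.biUnion (l1Ball k)).card : ℝ) ≤
        (l1Ball k x \ l1Ball k y).card + ((y :: l).toFinset.biUnion (l1Ball k)).card := by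
      exact_mod_cast (Finset.card_le_card h1).trans (Finset.card_union_le _ _)
    obtain ⟨t, ht⟩ := Int.eq_ofNat_of_zero_le (l1Dist_nonneg x y)
    have h3 := (card_l1Ball_sdiff_le k t ht).trans (hAB t)
    simp only [routeLen, ht, List.length_cons] at ih ⊢
    push_cast at ih ⊢
    linarith

/-- The trade-off between the length and the number of stops of a covering path: the stops, in the
order of their first visits, cover at most `ballSize k + ∑ f(dᵢ)` points, where the distances `dᵢ`
add up to at most the length of the path, and `f = fLBNat k` is concave. -/
theorem tradeoff {k n m : ℕ} {u v : ℤ × ℤ} {P : (gridGraph n m).Walk u v} {S : Finset (ℤ × ℤ)}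
    (h : IsCoveringPath k n m P S) (hN : (ballSize k : ℝ) < m * n) :
    1 < (S.card : ℝ) ∧ 1 ≤ (P.length : ℝ) / (S.card - 1) ∧
      (m : ℝ) * n - ballSize k ≤ (S.card - 1) * fLB k (P.length / (S.card - 1)) := by
  classical
  obtain ⟨-, hS2, hS3⟩ := h
  set l := P.support.dedup.filter (· ∈ S) with hl
  have hlS : l.toFinset = S := by
    ext z; simp only [hl, List.mem_toFinset, List.mem_filter, List.mem_dedup, decide_eq_true_eq]
    exact ⟨fun hz => hz.2, fun hz => ⟨hS2 z hz, hz⟩⟩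
  have hnd : l.Nodup := (List.nodup_dedup _).filter _
  have hlen : l.length = S.card := by rw [← hlS, List.toFinset_card_of_nodup hnd]
  have hroute : (routeLen l : ℝ) ≤ P.length := by
    exact_mod_cast routeLen_le_length P (List.filter_sublist.trans (List.dedup_sublist _))
  have hgrid : ((gridPoints n m).card : ℝ) = (n + 1) * (m + 1) := by
    simp [gridPoints, Finset.card_product]
  have hcov : gridPoints n m ⊆ l.toFinset.biUnion (l1Ball k) := by
    intro z hz
    obtain ⟨s, hs, hsz⟩ := hS3 z hz
    rw [hlS]
    exact Finset.mem_biUnion.2 ⟨s, hs, mem_l1Ball.2 hsz⟩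
  have hcov2 : ((m : ℝ) * n) ≤ ((l.toFinset.biUnion (l1Ball k)).card : ℝ) := by
    have h1 : ((gridPoints n m).card : ℝ) ≤ _ := Nat.cast_le.2 (Finset.card_le_card hcov)
    rw [hgrid] at h1
    nlinarith [(Nat.cast_nonneg n : (0 : ℝ) ≤ n), (Nat.cast_nonneg m : (0 : ℝ) ≤ m)]
  have hcard : 1 < S.card := by
    by_contra hc
    have h1 : (l.toFinset.biUnion (l1Ball k)).card ≤ S.card * ballSize k := by
      rw [hlS]
      exact Finset.card_biUnion_le_card_mul _ _ _ fun s _ => (card_l1Ball k s).le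
    have h2 : (l.toFinset.biUnion (l1Ball k)).card ≤ ballSize k := by
      refine h1.trans ?_
      have h3 : S.card ≤ 1 := by omega
      calc S.card * ballSize k ≤ 1 * ballSize k := Nat.mul_le_mul_right _ h3
        _ = ballSize k := one_mul _
    have h3 : ((l.toFinset.biUnion (l1Ball k)).card : ℝ) ≤ ballSize k := by exact_mod_cast h2
    linarith
  have hcard' : 1 < (S.card : ℝ) := by exact_mod_cast hcard
  have hpos : 0 < (S.card : ℝ) - 1 := by linarith
  refine ⟨hcard', ?_, ?_⟩
  · rw [le_div_iff₀ hpos, one_mul]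
    have h1 : S.card ≤ P.length + 1 := by
      rw [← SimpleGraph.Walk.length_support, ← hlen]
      exact (List.filter_sublist.trans (List.dedup_sublist _)).length_le
    have h2 : (S.card : ℝ) ≤ P.length + 1 := by exact_mod_cast h1
    linarith
  · set j := ⌊(P.length : ℝ) / (S.card - 1)⌋₊ with hj
    have h1 := card_cover_le k (fLBNat k j - j * fLBStep k j) (fLBStep k j)
      (fun t => (fLBNat_le_line k j t).trans (le_of_eq (by ring))) l
      (by rintro h0; rw [h0] at hlen; simp at hlen; omega)
    rw [hlen] at h1
    rw [fLB_eq, ← hj]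
    have h2 : ((S.card : ℝ) - 1) * (fLBNat k j +
        ((P.length : ℝ) / (S.card - 1) - j) * fLBStep k j) =
        (fLBNat k j - j * fLBStep k j) * (S.card - 1) + fLBStep k j * P.length := by
      field_simp; ring
    rw [h2]
    have h3 : (fLBStep k j : ℝ) * routeLen l ≤ fLBStep k j * P.length :=
      mul_le_mul_of_nonneg_left hroute (by positivity)
    linarith

theorem mem_lowerBoundary {k n m : ℕ} {q : ℝ × ℝ} : q ∈ lowerBoundary k n m ↔
    1 < q.2 ∧ 1 ≤ q.1 / (q.2 - 1) ∧
      (q.2 - 1) * fLB k (q.1 / (q.2 - 1)) = (m : ℝ) * n - ballSize k := by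
  simp [lowerBoundary, ballSize]

/-- Scaling the length and the number of stops after the first one down to the boundary of the
trade-off constraint does not increase the cost. -/
theorem relaxed_le_pathCost {k n m : ℕ} {α β : ℝ} (hα : 0 ≤ α) (hβ : 0 ≤ β) {q : ℝ × ℝ}
    (hq : IsRelaxedOptimum k n m α β q) (hN : (ballSize k : ℝ) < m * n) {u v : ℤ × ℤ}
    {P : (gridGraph n m).Walk u v} {S : Finset (ℤ × ℤ)} (h : IsCoveringPath k n m P S) :
    α * q.1 + β * q.2 ≤ pathCost α β P S := by
  obtain ⟨h1, h2, h3⟩ := tradeoff h hN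
  set L : ℝ := (P.length : ℝ) with hL
  have hS : 0 < (S.card : ℝ) - 1 := by linarith
  set s : ℝ := (S.card : ℝ) - 1 with hs
  have hL0 : 0 ≤ L := by positivity
  have hM : 0 < (m : ℝ) * n - ballSize k := by linarith
  set M : ℝ := (m : ℝ) * n - ballSize k
  have hg : 0 < s * fLB k (L / s) := lt_of_lt_of_le hM h3
  have hf : 0 < fLB k (L / s) := by linarith [one_le_fLB k h2]
  set c := M / (s * fLB k (L / s)) with hc
  have hc0 : 0 < c := by positivity
  have hc1 : c ≤ 1 := (div_le_one hg).2 h3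
  have hmem : (c * L, c * s + 1) ∈ lowerBoundary k n m := by
    rw [mem_lowerBoundary]
    have h4 : c * L / (c * s + 1 - 1) = L / s := by
      rw [add_sub_cancel_right, mul_div_mul_left _ _ hc0.ne']
    simp only [h4]
    refine ⟨by nlinarith [mul_pos hc0 hS], h2, ?_⟩
    rw [add_sub_cancel_right, hc]
    field_simp
    rfl
  refine (hq.2 _ hmem).trans ?_
  have h5 : c * L ≤ L := by nlinarith
  have h6 : c * s + 1 ≤ S.card := by nlinarith
  simp only [pathCost]
  nlinarith [mul_le_mul_of_nonneg_left h5 hα, mul_le_mul_of_nonneg_left h6 hβ]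

/-- In terms of `d = L / (T - 1)` the cost is `(α d + β) M / f(d) + β`, and since `f` is piecewise
linear and constant from `2k + 1` on, the minimum is attained at an integer `d ≤ 2k + 1`. -/
theorem exists_isRelaxedOptimum {k n m : ℕ} {α β : ℝ} (hα : 0 ≤ α)
    (hN : (ballSize k : ℝ) < m * n) : ∃ q : ℝ × ℝ, IsRelaxedOptimum k n m α β q := by
  obtain ⟨j, hj, hmin⟩ := Finset.exists_min_image (Finset.Icc 1 (2 * k + 1))
    (fun j : ℕ => (α * j + β) / fLBNat k j) ⟨1, by simp⟩
  rw [Finset.mem_Icc] at hj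
  have hfpos : ∀ i : ℕ, 1 ≤ i → 0 < fLBNat k i := fun i hi => by
    have := fLBNat_mono k hi
    rw [fLBNat_one] at this
    have : (0 : ℝ) ≤ k := by positivity
    linarith
  set μ := (α * j + β) / fLBNat k j with hμ
  have hint : ∀ i : ℕ, 1 ≤ i → μ * fLBNat k i ≤ α * i + β := by
    intro i hi
    rcases le_total i (2 * k + 1) with h | h
    · have h1 := hmin i (Finset.mem_Icc.2 ⟨hi, h⟩)
      exact (le_div_iff₀ (hfpos i hi)).1 h1
    · have h1 := hmin (2 * k + 1) (Finset.mem_Icc.2 ⟨by omega, le_rfl⟩)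
      have h2 := (le_div_iff₀ (hfpos _ (by omega))).1 h1
      rw [fLBNat_of_lt (by omega)] at h2 ⊢
      refine h2.trans ?_
      have h3 : ((2 * k + 1 : ℕ) : ℝ) ≤ i := by exact_mod_cast h
      nlinarith
  have hreal : ∀ d : ℝ, 1 ≤ d → μ * fLB k d ≤ α * d + β := by
    intro d hd
    have h1 : 1 ≤ ⌊d⌋₊ := (Nat.one_le_floor_iff d).2 hd
    have h2 := hint _ h1
    have h3 := hint (⌊d⌋₊ + 1) (by omega)
    have h4 : (⌊d⌋₊ : ℝ) ≤ d := Nat.floor_le (by linarith)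
    have h5 : d < ⌊d⌋₊ + 1 := Nat.lt_floor_add_one d
    push_cast at h3
    rw [fLB]
    have h6 := mul_le_mul_of_nonneg_left h2 (show 0 ≤ (⌊d⌋₊ : ℝ) + 1 - d by linarith)
    have h7 := mul_le_mul_of_nonneg_left h3 (show 0 ≤ d - (⌊d⌋₊ : ℝ) by linarith)
    nlinarith
  have hM : 0 < (m : ℝ) * n - ballSize k := by linarith
  set M : ℝ := (m : ℝ) * n - ballSize k with hMdef
  have hfj := hfpos j hj.1
  have hfl : fLB k j = fLBNat k j := by simp [fLB]
  have hj1 : (1 : ℝ) ≤ j := by exact_mod_cast hj.1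
  have hs : 0 < M / fLBNat k j := by positivity
  have hdiv : (j * (M / fLBNat k j)) / (M / fLBNat k j) = (j : ℝ) := by field_simp
  refine ⟨(j * (M / fLBNat k j), M / fLBNat k j + 1), ?_, ?_⟩
  · rw [mem_lowerBoundary]
    simp only [add_sub_cancel_right, hdiv]
    refine ⟨by linarith, hj1, ?_⟩
    rw [hfl]
    field_simp
    rfl
  · rintro ⟨L, T⟩ hq
    rw [mem_lowerBoundary] at hq
    obtain ⟨h1, h2, h3⟩ := hq
    simp only at h1 h2 h3 ⊢
    have hT : 0 < T - 1 := by linarith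
    have h4 := hreal _ h2
    have h5 := mul_le_mul_of_nonneg_left h4 hT.le
    have h6 : (T - 1) * (α * (L / (T - 1)) + β) = α * L + β * (T - 1) := by
      field_simp
    rw [h6] at h5
    have h7 : (T - 1) * (μ * fLB k (L / (T - 1))) = μ * M := by
      rw [hMdef, ← h3]; ring
    rw [h7] at h5
    have h8 : α * (j * (M / fLBNat k j)) + β * (M / fLBNat k j + 1) = μ * M + β := by
      rw [hμ]; field_simp; ring
    rw [h8]
    linarith

/-! ### Routes through a list of points -/

theorem mem_gridPoints {n m : ℕ} {z : ℤ × ℤ} :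
    z ∈ gridPoints n m ↔ (0 ≤ z.1 ∧ z.1 ≤ n) ∧ 0 ≤ z.2 ∧ z.2 ≤ m := by
  simp [gridPoints]

/-- A shortest route between two grid points; if these lie on a vertical line, it visits all
points of the segment between them. -/
theorem exists_shortest_walk {n m : ℕ} (t : ℕ) : ∀ u v : ℤ × ℤ, u ∈ gridPoints n m →
    v ∈ gridPoints n m → l1Dist u v = t → ∃ P : (gridGraph n m).Walk u v, P.length = t ∧
      (u.1 = v.1 → ∀ s : ℤ × ℤ, s.1 = u.1 → s.2 ∈ Set.uIcc u.2 v.2 → s ∈ P.support) := by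
  induction t with
  | zero =>
    intro u v _ _ h
    obtain rfl := l1Dist_eq_zero h
    refine ⟨SimpleGraph.Walk.nil, rfl, fun _ s hs1 hs2 => ?_⟩
    rw [Set.uIcc_self, Set.mem_singleton_iff] at hs2
    simp [Prod.ext hs1 hs2]
  | succ t ih =>
    intro u v hu hv h
    have step : ∀ x : ℤ × ℤ, x ∈ gridPoints n m → l1Dist u x = 1 → l1Dist x v = t →
        (u.1 = v.1 → x.1 = u.1 ∧ ∀ y ∈ Set.uIcc u.2 v.2, y = u.2 ∨ y ∈ Set.uIcc x.2 v.2) →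
        ∃ P : (gridGraph n m).Walk u v, P.length = t + 1 ∧
        (u.1 = v.1 → ∀ s : ℤ × ℤ, s.1 = u.1 → s.2 ∈ Set.uIcc u.2 v.2 → s ∈ P.support) := by
      intro x hx hux hxv hseg
      obtain ⟨P, hP1, hP2⟩ := ih x v hx hv hxv
      have hadj : (gridGraph n m).Adj u x := ⟨hu, hx, hux⟩
      refine ⟨SimpleGraph.Walk.cons hadj P, by simp [hP1], fun h1 s hs1 hs2 => ?_⟩
      obtain ⟨h3, h4⟩ := hseg h1
      rw [SimpleGraph.Walk.support_cons, List.mem_cons]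
      rcases h4 _ hs2 with h5 | h5
      · exact Or.inl (Prod.ext hs1 h5)
      · exact Or.inr (hP2 (h3.trans h1) s (hs1.trans h3.symm) h5)
    rw [mem_gridPoints] at hu hv
    simp only [mem_gridPoints, l1Dist, abs_eq_max_neg, Set.mem_uIcc] at step h ⊢
    rcases lt_trichotomy u.1 v.1 with h1 | h1 | h1
    · refine step (u.1 + 1, u.2) ?_ ?_ ?_ ?_ <;> dsimp only <;> omega
    · rcases lt_trichotomy u.2 v.2 with h2 | h2 | h2
      · refine step (u.1, u.2 + 1) ?_ ?_ ?_ (fun _ => ⟨rfl, fun y hy => ?_⟩) <;>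
          dsimp only <;> omega
      · omega
      · refine step (u.1, u.2 - 1) ?_ ?_ ?_ (fun _ => ⟨rfl, fun y hy => ?_⟩) <;>
          dsimp only <;> omega
    · refine step (u.1 - 1, u.2) ?_ ?_ ?_ ?_ <;> dsimp only <;> omega

/-- `s` is one of the waypoints, or it lies on a vertical segment between two consecutive ones:
every route that follows the waypoints and goes straight along vertical segments visits `s`. -/
def Visits (l : List (ℤ × ℤ)) (s : ℤ × ℤ) : Prop :=
  s ∈ l ∨ ∃ x y, [x, y] <:+: l ∧ x.1 = y.1 ∧ s.1 = x.1 ∧ s.2 ∈ Set.uIcc x.2 y.2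

theorem Visits.of_infix {l l' : List (ℤ × ℤ)} {s : ℤ × ℤ} (h : l <:+: l') (hs : Visits l s) :
    Visits l' s := by
  rcases hs with hs | ⟨x, y, hxy, h2⟩
  · exact Or.inl (h.subset hs)
  · exact Or.inr ⟨x, y, hxy.trans h, h2⟩

theorem Visits.shift {l : List (ℤ × ℤ)} {s : ℤ × ℤ} (c : ℤ) (hs : Visits l s) :
    Visits (l.map fun z => (z.1 + c, z.2)) (s.1 + c, s.2) := by
  rcases hs with hs | ⟨x, y, hxy, h1, h2, h3⟩
  · exact Or.inl (List.mem_map_of_mem (f := fun z : ℤ × ℤ => (z.1 + c, z.2)) hs)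
  · exact Or.inr ⟨(x.1 + c, x.2), (y.1 + c, y.2),
      by simpa using hxy.map (fun z : ℤ × ℤ => (z.1 + c, z.2)), by simpa using h1,
      by simpa using h2, h3⟩

theorem exists_followsRoute {n m : ℕ} : ∀ l : List (ℤ × ℤ), l ≠ [] →
    (∀ z ∈ l, z ∈ gridPoints n m) → ∃ (u v : ℤ × ℤ) (P : (gridGraph n m).Walk u v),
      l.head? = some u ∧ FollowsRoute n m l P ∧ (P.length : ℤ) = routeLen l ∧
      ∀ s, Visits l s → s ∈ P.support
  | [], h, _ => absurd rfl h
  | [x], _, _ => by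
    refine ⟨x, x, SimpleGraph.Walk.nil, rfl, FollowsRoute.single x, rfl, ?_⟩
    rintro s (hs | ⟨a, b, hab, -⟩)
    · simpa using hs
    · have := hab.length_le
      simp at this
  | x :: y :: l, _, hmem => by
    obtain ⟨u, v, Q, hu, hQ1, hQ2, hQ3⟩ := exists_followsRoute (y :: l) (by simp)
      fun z hz => hmem z (List.mem_cons_of_mem _ hz)
    obtain rfl : y = u := by simpa using hu
    obtain ⟨t, ht⟩ := Int.eq_ofNat_of_zero_le (l1Dist_nonneg x y)
    obtain ⟨P, hP1, hP2⟩ := exists_shortest_walk t x y (hmem x (by simp)) (hmem y (by simp)) ht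
    refine ⟨x, v, P.append Q, rfl, FollowsRoute.cons P Q (by rw [hP1, ht]) hQ1, ?_, ?_⟩
    · rw [SimpleGraph.Walk.length_append, routeLen, ht, ← hQ2, hP1]
      push_cast; rfl
    · intro s hs
      rw [SimpleGraph.Walk.mem_support_append_iff]
      rcases hs with hs | ⟨a, b, hab, h1, h2, h3⟩
      · rcases List.mem_cons.1 hs with rfl | hs
        · exact Or.inl P.start_mem_support
        · exact Or.inr (hQ3 s (Or.inl hs))
      · rcases List.infix_cons_iff.1 hab with h | h
        · rw [List.cons_prefix_cons, List.cons_prefix_cons] at h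
          obtain ⟨rfl, rfl, -⟩ := h
          exact Or.inl (hP2 h1 s h2 h3)
        · exact Or.inr (hQ3 s (Or.inr ⟨a, b, h, h1, h2, h3⟩))

/-- The plan `A` describes a covering path of `gridPoints w m`. -/
structure IsCoveringPlan (k w m : ℕ) (A : PathPlan) : Prop where
  waypoints_ne_nil : A.waypoints ≠ []
  waypoints_mem : ∀ z ∈ A.waypoints, z ∈ gridPoints w m
  stops_mem : ∀ s ∈ A.stops, s ∈ gridPoints w m
  stops_visited : ∀ s ∈ A.stops, Visits A.waypoints s
  covers : ∀ z ∈ gridPoints w m, ∃ s ∈ A.stops, l1Dist s z ≤ k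

theorem IsCoveringPlan.exists_walk {k n m : ℕ} {A : PathPlan} (h : IsCoveringPlan k n m A) :
    ∃ (u v : ℤ × ℤ) (P : (gridGraph n m).Walk u v), FollowsRoute n m A.waypoints P ∧
      IsCoveringPath k n m P A.stops ∧ (P.length : ℤ) = routeLen A.waypoints := by
  obtain ⟨u, v, P, -, h1, h2, h3⟩ :=
    exists_followsRoute A.waypoints h.waypoints_ne_nil h.waypoints_mem
  exact ⟨u, v, P, h1, ⟨h.stops_mem, fun s hs => h3 s (h.stops_visited s hs), h.covers⟩, h2⟩

theorem IsCoveringPlan.append_shift {k w w' m : ℕ} {A B : PathPlan}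
    (hA : IsCoveringPlan k w m A) (hB : IsCoveringPlan k w' m B) :
    IsCoveringPlan k (w + w') m (A.append (B.shift w)) where
  waypoints_ne_nil := by simp [PathPlan.append, hA.waypoints_ne_nil]
  waypoints_mem := by
    intro z hz
    rcases List.mem_append.1 hz with hz | hz
    · have := mem_gridPoints.1 (hA.waypoints_mem z hz)
      rw [mem_gridPoints]; push_cast; omega
    · obtain ⟨y, hy, rfl⟩ := List.mem_map.1 hz
      have := mem_gridPoints.1 (hB.waypoints_mem y hy)
      rw [mem_gridPoints]; push_cast; omega
  stops_mem := by
    intro z hz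
    rcases Finset.mem_union.1 hz with hz | hz
    · have := mem_gridPoints.1 (hA.stops_mem z hz)
      rw [mem_gridPoints]; push_cast; omega
    · obtain ⟨y, hy, rfl⟩ := Finset.mem_image.1 hz
      have := mem_gridPoints.1 (hB.stops_mem y hy)
      rw [mem_gridPoints]; push_cast; omega
  stops_visited := by
    intro z hz
    rcases Finset.mem_union.1 hz with hz | hz
    · exact (hA.stops_visited z hz).of_infix (List.prefix_append _ _).isInfix
    · obtain ⟨y, hy, rfl⟩ := Finset.mem_image.1 hz
      exact ((hB.stops_visited y hy).shift w).of_infix (List.suffix_append _ _).isInfix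
  covers := by
    intro z hz
    rw [mem_gridPoints] at hz
    push_cast at hz
    rcases le_total z.1 w with h | h
    · obtain ⟨s, hs, hsz⟩ := hA.covers z (mem_gridPoints.2 (by omega))
      exact ⟨s, Finset.mem_union_left _ hs, hsz⟩
    · obtain ⟨s, hs, hsz⟩ := hB.covers (z.1 - w, z.2) (mem_gridPoints.2 (by dsimp only; omega))
      refine ⟨(s.1 + w, s.2), Finset.mem_union_right _ (Finset.mem_image.2 ⟨s, hs, rfl⟩), ?_⟩
      simp only [l1Dist] at hsz ⊢
      rwa [show s.1 + (w : ℤ) - z.1 = s.1 - (z.1 - w) by ring]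

theorem routeLen_map_le {f : ℤ × ℤ → ℤ × ℤ} (hf : ∀ x y, l1Dist (f x) (f y) ≤ l1Dist x y) :
    ∀ l : List (ℤ × ℤ), routeLen (l.map f) ≤ routeLen l
  | [] => le_rfl
  | [_] => le_rfl
  | x :: y :: l => by
    have := routeLen_map_le hf (y :: l)
    simp only [List.map_cons, routeLen] at this ⊢
    linarith [hf x y]

theorem routeLen_append_le {D : ℤ} (hD : 0 ≤ D) (l' : List (ℤ × ℤ)) : ∀ l : List (ℤ × ℤ),
    (∀ x ∈ l.getLast?, ∀ y ∈ l'.head?, l1Dist x y ≤ D) →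
      routeLen (l ++ l') ≤ routeLen l + D + routeLen l'
  | [], _ => by simp [routeLen, hD]
  | [x], h => by
    cases l' with
    | nil => simpa [routeLen] using hD
    | cons y l' => simpa [routeLen] using h x (by simp) y (by simp)
  | x :: y :: l, h => by
    have := routeLen_append_le hD l' (y :: l) (by simpa [List.getLast?_cons_cons] using h)
    simp only [List.cons_append, routeLen] at this ⊢
    linarith

theorem routeLen_append_shift_le {k w w' m : ℕ} {A B : PathPlan}
    (hA : IsCoveringPlan k w m A) (hB : IsCoveringPlan k w' m B) :
    routeLen (A.append (B.shift w)).waypoints ≤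
      routeLen A.waypoints + (w + w' + m) + routeLen B.waypoints := by
  refine (routeLen_append_le (D := w + w' + m) (by positivity) _ _ ?_).trans
    (add_le_add_right (routeLen_map_le (fun x y => by simp [l1Dist]) _) _)
  intro x hx y hy
  have h1 := mem_gridPoints.1 (hA.waypoints_mem x (List.mem_of_getLast? hx))
  obtain ⟨b, hb, rfl⟩ := List.mem_map.1 (List.mem_of_head? hy)
  have h2 := mem_gridPoints.1 (hB.waypoints_mem b hb)
  simp only [l1Dist, abs_eq_max_neg]
  omega

theorem card_stops_append_shift_le (A B : PathPlan) (w : ℕ) :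
    (A.append (B.shift w)).stops.card ≤ A.stops.card + B.stops.card :=
  (Finset.card_union_le _ _).trans (Nat.add_le_add_left Finset.card_image_le _)

/-! ### Up-and-down paths with vertical traversals -/

/-- The types `1, 2, 4, …, 2k` of the up-and-down paths with vertical traversals. -/
def IsUpDownType (k d : ℕ) : Prop := d = 1 ∨ ∃ h, d = 2 * h ∧ 1 ≤ h ∧ h ≤ k

theorem separation_pos (k d : ℕ) (hd : IsUpDownType k d) : 0 < separation k d := by
  rcases hd with rfl | ⟨h, rfl, h1, h2⟩
  · simp [separation]
  · rw [separation, if_neg (by omega)]; omega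

theorem traversalX_le (k d w i : ℕ) : traversalX k d w i ≤ w := min_le_right _ _

theorem mem_upDownPlan_stops {k d w m : ℕ} {s : ℤ × ℤ} : s ∈ (upDownPlan k d w m).stops ↔
    ∃ i < traversalCount k d w, ∃ y ≤ m, (y % d = (if Even i then 0 else d / 2) ∨ y = m) ∧
      s = ((traversalX k d w i : ℤ), (y : ℤ)) := by
  simp only [upDownPlan, Finset.mem_biUnion, Finset.mem_range, Finset.mem_image,
    Finset.mem_filter, Nat.lt_succ_iff, and_assoc, eq_comm (a := s)]

/-- Two stops near height `y`, one in each of the two interleaved sets of heights. -/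
theorem exists_interleaved_stops {h m y : ℕ} (hh : 1 ≤ h) (hy : y ≤ m) :
    ∃ a ≤ m, ∃ b ≤ m, (a % (2 * h) = 0 ∨ a = m) ∧ (b % (2 * h) = h ∨ b = m) ∧
      |(y : ℤ) - a| + |(y : ℤ) - b| ≤ h := by
  have h1 : h * (y / h) ≤ y := Nat.mul_div_le y h
  have h2 : y < h * (y / h) + h := by
    have := Nat.lt_mul_div_succ y hh
    linarith
  have h3 : ∀ x, min x m % (2 * h) = x % (2 * h) ∨ min x m = m := fun x => by
    rcases le_total x m with h | h
    · left; rw [min_eq_left h]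
    · right; exact min_eq_right h
  rcases Nat.even_or_odd' (y / h) with ⟨c, hc | hc⟩
  · rw [hc] at h1 h2
    have h4 : h * (2 * c) % (2 * h) = 0 := Nat.mod_eq_zero_of_dvd ⟨c, by ring⟩
    have h5 : (h * (2 * c) + h) % (2 * h) = h := by
      rw [Nat.add_mod, h4, zero_add, Nat.mod_mod, Nat.mod_eq_of_lt (by omega)]
    generalize h * (2 * c) = x at *
    refine ⟨min x m, min_le_right _ _, min (x + h) m, min_le_right _ _, ?_, ?_, ?_⟩
    · rw [← h4]; exact h3 _
    · have := h3 (x + h)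
      rwa [h5] at this
    · simp only [abs_eq_max_neg]; omega
  · rw [hc] at h1 h2
    have h4 : h * (2 * c + 1) % (2 * h) = h := by
      rw [show h * (2 * c + 1) = h + 2 * h * c by ring, Nat.add_mul_mod_self_left,
        Nat.mod_eq_of_lt (by omega)]
    have h5 : (h * (2 * c + 1) + h) % (2 * h) = 0 :=
      Nat.mod_eq_zero_of_dvd ⟨c + 1, by ring⟩
    generalize h * (2 * c + 1) = x at *
    refine ⟨min (x + h) m, min_le_right _ _, min x m, min_le_right _ _, ?_, ?_, ?_⟩
    · rw [← h5]; exact h3 _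
    · have := h3 x
      rwa [h4] at this
    · simp only [abs_eq_max_neg]; omega

/-- A point between two consecutive traversals is covered from one of them, because its vertical
distances to the stops of the one and the other add up to at most `d / 2`. -/
theorem upDownPlan_covers {k d w m : ℕ} (hd : IsUpDownType k d) (hw : 1 ≤ w) {z : ℤ × ℤ}
    (hz : z ∈ gridPoints w m) : ∃ s ∈ (upDownPlan k d w m).stops, l1Dist s z ≤ k := by
  obtain ⟨x, y⟩ := z
  rw [mem_gridPoints] at hz
  dsimp only at hz
  lift x to ℕ using hz.1.1
  lift y to ℕ using hz.2.1
  have hs := separation_pos k d hd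
  set s := separation k d with hsdef
  obtain ⟨i, hi1, hi2, hi3⟩ : ∃ i, i * s ≤ x ∧ x ≤ (i + 1) * s ∧
      i + 1 < traversalCount k d w := by
    refine ⟨(x - 1) / s, (Nat.div_mul_le_self _ _).trans (by omega), ?_, ?_⟩
    · have := Nat.lt_mul_div_succ (x - 1) hs
      rw [mul_comm]; omega
    · rw [traversalCount, ← hsdef]
      have h1 : (x - 1) / s + 1 = (x - 1 + s) / s := (Nat.add_div_right _ hs).symm
      have h2 : (x - 1 + s) / s ≤ (w + s - 1) / s := Nat.div_le_div_right (by omega)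
      omega
  have hX0 : traversalX k d w i = i * s := by
    rw [traversalX, ← hsdef]; omega
  have hX1 : x ≤ traversalX k d w (i + 1) ∧ traversalX k d w (i + 1) ≤ i * s + s := by
    rw [traversalX, ← hsdef, show (i + 1) * s = i * s + s by ring] at *; omega
  have hsum : ∃ a ≤ m, ∃ b ≤ m, (a % d = (if Even i then 0 else d / 2) ∨ a = m) ∧
      (b % d = (if Even (i + 1) then 0 else d / 2) ∨ b = m) ∧
      |(y : ℤ) - a| + |(y : ℤ) - b| + s ≤ 2 * k + 1 := by
    rcases hd with rfl | ⟨h, rfl, h1, h2⟩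
    · refine ⟨y, by omega, y, by omega, ?_, ?_, ?_⟩
      · simp [Nat.mod_one]
      · simp [Nat.mod_one]
      · simp [hsdef, separation]
    · have hs2 : s = 2 * k + 1 - h := by rw [hsdef, separation, if_neg (by omega)]; omega
      have h3 : 2 * h / 2 = h := by omega
      obtain ⟨a, ha, b, hb, hae, hbo, hab⟩ := exists_interleaved_stops (h := h) (m := m) (y := y)
        h1 (by omega)
      rcases Nat.even_or_odd i with hi | hi
      · refine ⟨a, ha, b, hb, ?_, ?_, by omega⟩
        · rwa [if_pos hi]
        · rwa [if_neg (by simpa [Nat.even_add_one] using hi), h3]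
      · refine ⟨b, hb, a, ha, ?_, ?_, by omega⟩
        · rwa [if_neg (Nat.not_even_iff_odd.2 hi), h3]
        · rwa [if_pos (by simpa [Nat.even_add_one] using hi)]
  obtain ⟨a, ha, b, hb, ha2, hb2, hab⟩ := hsum
  by_cases hk : (x : ℤ) - i * s + |(y : ℤ) - a| ≤ k
  · refine ⟨_, mem_upDownPlan_stops.2 ⟨i, by omega, a, ha, ha2, rfl⟩, ?_⟩
    rw [hX0]
    simp only [l1Dist]
    have : ((i * s : ℕ) : ℤ) ≤ x := by exact_mod_cast hi1
    push_cast at this ⊢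
    rw [abs_sub_comm, abs_of_nonneg (by linarith), abs_sub_comm (a : ℤ)]
    exact hk
  · refine ⟨_, mem_upDownPlan_stops.2 ⟨i + 1, hi3, b, hb, hb2, rfl⟩, ?_⟩
    simp only [l1Dist]
    have h1 : (x : ℤ) ≤ traversalX k d w (i + 1) := by exact_mod_cast hX1.1
    have h2 : (traversalX k d w (i + 1) : ℤ) ≤ i * s + s := by exact_mod_cast hX1.2
    rw [abs_of_nonneg (by linarith), abs_sub_comm (b : ℤ)]
    linarith

theorem upDownPlan_isCovering {k d w : ℕ} (m : ℕ) (hd : IsUpDownType k d) (hw : 1 ≤ w) :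
    IsCoveringPlan k w m (upDownPlan k d w m) where
  waypoints_ne_nil := by
    have h1 : (0 : ℕ) ∈ List.range (traversalCount k d w) := by simp [traversalCount]
    intro h2
    have := (List.flatMap_eq_nil_iff.1 h2) 0 h1
    simp at this
  waypoints_mem := by
    intro z hz
    obtain ⟨i, -, hz⟩ := List.mem_flatMap.1 hz
    have := traversalX_le k d w i
    rw [mem_gridPoints]
    split_ifs at hz <;> simp only [List.mem_cons, List.not_mem_nil, or_false] at hz <;>
      rcases hz with rfl | rfl <;> dsimp only <;> omega
  stops_mem := by
    intro s hs
    obtain ⟨i, -, y, hy, -, rfl⟩ := mem_upDownPlan_stops.1 hs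
    have := traversalX_le k d w i
    rw [mem_gridPoints]
    dsimp only; omega
  stops_visited := by
    intro s hs
    obtain ⟨i, hi, y, hy, -, rfl⟩ := mem_upDownPlan_stops.1 hs
    have hinf : (if Even i then [((traversalX k d w i : ℤ), (0 : ℤ)),
        ((traversalX k d w i : ℤ), (m : ℤ))]
        else [((traversalX k d w i : ℤ), (m : ℤ)), ((traversalX k d w i : ℤ), 0)]) <:+:
        (upDownPlan k d w m).waypoints :=
      List.infix_of_mem_flatten (List.mem_map.2 ⟨i, List.mem_range.2 hi, rfl⟩)
    refine Visits.of_infix hinf ?_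
    split_ifs
    · exact Or.inr ⟨_, _, List.infix_rfl, rfl, rfl, by rw [Set.mem_uIcc]; dsimp only; omega⟩
    · exact Or.inr ⟨_, _, List.infix_rfl, rfl, rfl, by rw [Set.mem_uIcc]; dsimp only; omega⟩
  covers := fun _ hz => upDownPlan_covers hd hw hz

theorem traversalX_mono (k d w i : ℕ) : traversalX k d w i ≤ traversalX k d w (i + 1) :=
  min_le_min_right _ (Nat.mul_le_mul_right _ (Nat.le_succ i))

theorem routeLen_traversals_le (k d w m c : ℕ) :
    routeLen ((List.range (c + 1)).flatMap fun i =>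
      if Even i then [((traversalX k d w i : ℤ), 0), ((traversalX k d w i : ℤ), (m : ℤ))]
      else [((traversalX k d w i : ℤ), (m : ℤ)), ((traversalX k d w i : ℤ), 0)]) ≤
    (c + 1) * m + traversalX k d w c := by
  induction c with
  | zero => simp [routeLen, l1Dist, traversalX]
  | succ c ih =>
    have hX := traversalX_mono k d w c
    rw [List.range_succ, List.flatMap_append]
    refine (routeLen_append_le (D := traversalX k d w (c + 1) - traversalX k d w c)
      (by omega) _ _ ?_).trans ?_
    · rw [List.range_succ, List.flatMap_append]
      intro x hx y hy
      rcases Nat.even_or_odd c with hc | hc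
      · have hc2 : ¬ Even (c + 1) := by simpa [Nat.even_add_one] using hc
        simp [hc, hc2] at hx hy
        subst hx hy
        simp only [l1Dist, abs_eq_max_neg]; omega
      · have hc2 : Even (c + 1) := by simpa [Nat.even_add_one] using hc
        have hc3 := Nat.not_even_iff_odd.2 hc
        simp [hc2, hc3] at hx hy
        subst hx hy
        simp only [l1Dist, abs_eq_max_neg]; omega
    · have h1 : routeLen ([c + 1].flatMap fun i =>
          if Even i then [((traversalX k d w i : ℤ), 0), ((traversalX k d w i : ℤ), (m : ℤ))]
          else [((traversalX k d w i : ℤ), (m : ℤ)), ((traversalX k d w i : ℤ), 0)]) = m := by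
        rw [List.flatMap_singleton]
        split_ifs <;> simp [routeLen, l1Dist]
      rw [h1]
      push_cast
      linarith

theorem traversalCount_le {k d : ℕ} (w : ℕ) (hd : IsUpDownType k d) :
    (traversalCount k d w : ℝ) ≤ w / separation k d + 2 := by
  have hs : (0 : ℝ) < separation k d := by exact_mod_cast separation_pos k d hd
  have h1 : (((w + separation k d - 1) / separation k d : ℕ) : ℝ) ≤
      ((w + separation k d : ℕ) : ℝ) / separation k d :=
    Nat.cast_div_le.trans (by gcongr; omega)
  rw [traversalCount]
  push_cast at h1 ⊢
  rw [add_div, div_self hs.ne'] at h1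
  linarith

theorem routeLen_upDownPlan_le {k d : ℕ} (w m : ℕ) (hd : IsUpDownType k d) :
    (routeLen (upDownPlan k d w m).waypoints : ℝ) ≤ w * m / separation k d + 2 * m + w := by
  have h1 := traversalCount_le w hd
  have h2 := routeLen_traversals_le k d w m ((w + separation k d - 1) / separation k d)
  have h3 : (routeLen (upDownPlan k d w m).waypoints : ℝ) ≤ traversalCount k d w * m + w := by
    have h4 := traversalX_le k d w ((w + separation k d - 1) / separation k d)
    have h5 : routeLen (upDownPlan k d w m).waypoints ≤ traversalCount k d w * m + w := by
      refine h2.trans ?_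
      simp only [traversalCount]
      push_cast
      have : (traversalX k d w ((w + separation k d - 1) / separation k d) : ℤ) ≤ w := by
        exact_mod_cast h4
      linarith
    exact_mod_cast h5
  refine h3.trans ?_
  have h6 := mul_le_mul_of_nonneg_right h1 (Nat.cast_nonneg m : (0 : ℝ) ≤ m)
  have h7 : ((w : ℝ) / separation k d + 2) * m = w * m / separation k d + 2 * m := by ring
  linarith

theorem card_upDownPlan_stops_le {k d : ℕ} (w m : ℕ) (hd : IsUpDownType k d) :
    ((upDownPlan k d w m).stops.card : ℝ) ≤
      ((w : ℝ) / separation k d + 2) * (m / d + 2) := by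
  have hd0 : 0 < d := by rcases hd with rfl | ⟨h, rfl, h1, h2⟩ <;> omega
  have h1 : (upDownPlan k d w m).stops.card ≤ traversalCount k d w * (m / d + 2) := by
    have := Finset.card_biUnion_le_card_mul (Finset.range (traversalCount k d w))
      (fun i => ((Finset.range (m + 1)).filter fun y =>
        y % d = (if Even i then 0 else d / 2) ∨ y = m).image
          fun y : ℕ => ((traversalX k d w i : ℤ), (y : ℤ))) (m / d + 2) ?_
    · rwa [Finset.card_range] at this
    · intro i _
      refine Finset.card_image_le.trans ?_
      set r := if Even i then 0 else d / 2
      rw [Finset.filter_or]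
      refine (Finset.card_union_le _ _).trans ?_
      have h2 : ((Finset.range (m + 1)).filter fun y => y % d = r).card ≤ m / d + 1 := by
        rw [← Finset.card_range (m / d + 1)]
        refine Finset.card_le_card_of_injOn (fun y => y / d) ?_ ?_
        · intro y hy
          simp only [Finset.coe_filter, Finset.mem_range, Set.mem_ofPred_eq] at hy
          simp only [Finset.coe_range, Set.mem_Iio]
          have := Nat.div_le_div_right (c := d) (show y ≤ m by omega)
          omega
        · intro y hy y' hy' hyy
          simp only [Finset.coe_filter, Finset.mem_range, Set.mem_ofPred_eq] at hy hy' hyy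
          rw [← Nat.div_add_mod y d, ← Nat.div_add_mod y' d, hyy, hy.2, hy'.2]
      have h3 : ((Finset.range (m + 1)).filter fun y => y = m).card ≤ 1 :=
        Finset.card_le_one.2 fun a ha b hb => by
          rw [(Finset.mem_filter.1 ha).2, (Finset.mem_filter.1 hb).2]
      omega
  have h4 : ((upDownPlan k d w m).stops.card : ℝ) ≤
      traversalCount k d w * ((m / d : ℕ) + 2) := by exact_mod_cast h1
  refine h4.trans (mul_le_mul (traversalCount_le w hd) ?_ (by positivity) (by positivity))
  linarith [Nat.cast_div_le (α := ℝ) (m := m) (n := d)]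

/-! ### The tessellation and its rotated traversals -/

theorem ballSize_pos (k : ℕ) : 0 < ballSize k := by unfold ballSize; omega

theorem ballSize_cast (k : ℕ) : (ballSize k : ℤ) = 2 * (k : ℤ) ^ 2 + 2 * k + 1 := by
  simp [ballSize]

/-- Two points of a ball of radius `k` are told apart by `tessForm k` modulo `ballSize k`: the form
takes at most the value `(k + 1) * 2k < ballSize k` on their difference, and its kernel is spanned
by a vector of length `2k + 1`. -/
theorem eq_of_ballSize_dvd {k : ℕ} {c u v : ℤ × ℤ} (hu : l1Dist c u ≤ k) (hv : l1Dist c v ≤ k)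
    (h : (ballSize k : ℤ) ∣ tessForm k u - tessForm k v) : u = v := by
  have huv : l1Dist u v ≤ 2 * k := by
    have := l1Dist_triangle u c v
    rw [l1Dist_comm u c] at this
    linarith
  have hk : (0 : ℤ) ≤ k := by positivity
  obtain ⟨q, hq⟩ := h
  have hform : tessForm k u - tessForm k v = k * (u.1 - v.1) + (k + 1) * (u.2 - v.2) := by
    simp only [tessForm]; ring
  rw [hform, ballSize_cast] at hq
  simp only [l1Dist] at huv
  generalize hx : u.1 - v.1 = x at *
  generalize hy : u.2 - v.2 = y at *
  have h1 := abs_le.1 (le_refl |x|)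
  have h2 := abs_le.1 (le_refl |y|)
  have hq0 : q = 0 := by
    have h3 : q < 1 := by
      by_contra hc
      nlinarith [abs_nonneg x, abs_nonneg y]
    have h4 : -1 < q := by
      by_contra hc
      nlinarith [abs_nonneg x, abs_nonneg y]
    omega
  rw [hq0, mul_zero] at hq
  have hy2 : y = -(k * (x + y)) := by linarith
  have hx2 : x = (k + 1) * (x + y) := by linarith
  have he : x + y = 0 := by
    generalize x + y = e at *
    subst hx2 hy2
    have h3 : e < 1 := by
      by_contra hc
      nlinarith [abs_nonneg ((k + 1) * e), abs_nonneg (-(k * e))]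
    have h4 : -1 < e := by
      by_contra hc
      nlinarith [abs_nonneg ((k + 1) * e), abs_nonneg (-(k * e))]
    omega
  rw [he] at hx2 hy2
  simp only [mul_zero, neg_zero] at hx2 hy2
  ext <;> omega

/-- The balls of radius `k` around the points of the tessellation cover the integer points: the
residues of `tessForm k` on the ball around `x` are distinct, and there are as many as points. -/
theorem exists_tess_near (k : ℕ) (x : ℤ × ℤ) :
    ∃ z, (ballSize k : ℤ) ∣ tessForm k z ∧ l1Dist z x ≤ k := by
  have : NeZero (ballSize k) := ⟨(ballSize_pos k).ne'⟩
  have hinj : Set.InjOn (fun z => (tessForm k z : ZMod (ballSize k))) (l1Ball k x) := by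
    intro u hu v hv huv
    refine (eq_of_ballSize_dvd (mem_l1Ball.1 hv) (mem_l1Ball.1 hu) ?_).symm
    exact (ZMod.intCast_eq_intCast_iff_dvd_sub _ _ _).1 huv
  have himg : (l1Ball k x).image (fun z => (tessForm k z : ZMod (ballSize k))) = Finset.univ := by
    rw [← Finset.card_eq_iff_eq_univ, Finset.card_image_of_injOn hinj, card_l1Ball, ZMod.card]
  obtain ⟨z, hz, hz0⟩ := Finset.mem_image.1 (himg ▸ Finset.mem_univ (0 : ZMod (ballSize k)))
  exact ⟨z, (ZMod.intCast_zmod_eq_zero_iff_dvd _ _).1 hz0, by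
    rw [l1Dist_comm]; exact mem_l1Ball.1 hz⟩

theorem mem_tessPoints {k w m : ℕ} {z : ℤ × ℤ} : z ∈ tessPoints k w m ↔
    (ballSize k : ℤ) ∣ tessForm k z ∧
      max 0 (max (-z.1) (z.1 - w)) + max 0 (max (-z.2) (z.2 - m)) ≤ k := by
  rw [tessPoints, Finset.mem_filter, Finset.mem_product, Finset.mem_Icc, Finset.mem_Icc]
  constructor
  · rintro ⟨-, h1, x, hx, hxz⟩
    rw [mem_gridPoints] at hx
    simp only [l1Dist, abs_eq_max_neg] at hxz
    exact ⟨h1, by omega⟩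
  · rintro ⟨h1, h2⟩
    refine ⟨by omega, h1, (max 0 (min z.1 w), max 0 (min z.2 m)), ?_, ?_⟩
    · rw [mem_gridPoints]; dsimp only; omega
    · simp only [l1Dist, abs_eq_max_neg]; omega

theorem card_tessPoints_mul_le (k w m : ℕ) :
    (tessPoints k w m).card * ballSize k ≤ (w + 4 * k + 1) * (m + 4 * k + 1) := by
  have hdisj : (tessPoints k w m : Set (ℤ × ℤ)).PairwiseDisjoint (l1Ball k) := by
    intro u hu v hv huv
    rw [Function.onFun, Finset.disjoint_left]
    intro z hzu hzv
    rw [mem_l1Ball, l1Dist_comm] at hzu hzv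
    exact huv (eq_of_ballSize_dvd hzu hzv
      (dvd_sub (mem_tessPoints.1 hu).1 (mem_tessPoints.1 hv).1))
  have h1 : ((tessPoints k w m).biUnion (l1Ball k)).card =
      (tessPoints k w m).card * ballSize k := by
    rw [Finset.card_biUnion hdisj, Finset.sum_congr rfl fun z _ => card_l1Ball k z,
      Finset.sum_const, smul_eq_mul]
  have h2 : (tessPoints k w m).biUnion (l1Ball k) ⊆
      Finset.Icc (-2 * (k : ℤ)) (w + 2 * k) ×ˢ Finset.Icc (-2 * (k : ℤ)) (m + 2 * k) := by
    intro z hz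
    obtain ⟨u, hu, huz⟩ := Finset.mem_biUnion.1 hz
    have hu := (mem_tessPoints.1 hu).2
    rw [mem_l1Ball] at huz
    simp only [l1Dist, abs_eq_max_neg] at huz
    rw [Finset.mem_product, Finset.mem_Icc, Finset.mem_Icc]
    omega
  rw [← h1]
  refine (Finset.card_le_card h2).trans (le_of_eq ?_)
  rw [Finset.card_product, Int.card_Icc, Int.card_Icc]
  congr 1 <;> omega

theorem eq_of_tessForm_eq {k : ℕ} {i : ℤ} {z : ℤ × ℤ} (h : tessForm k z = i * ballSize k) :
    (z.1, (i * ballSize k - k * z.1) / ((k : ℤ) + 1)) = z := by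
  have h1 : i * ballSize k - k * z.1 = (k + 1) * z.2 := by rw [← h, tessForm]; ring
  rw [h1, Int.mul_ediv_cancel_left _ (by positivity)]

theorem mem_tessTraversal {k w m : ℕ} {i : ℤ} {z : ℤ × ℤ} : z ∈ tessTraversal k w m i ↔
    z ∈ tessPoints k w m ∧ tessForm k z = i * ballSize k := by
  simp only [tessTraversal, List.mem_map, Finset.mem_sort, Finset.mem_image, Finset.mem_filter]
  constructor
  · rintro ⟨a, ⟨y, hy, rfl⟩, rfl⟩
    rwa [eq_of_tessForm_eq hy.2]
  · rintro hz
    exact ⟨z.1, ⟨z, hz, rfl⟩, eq_of_tessForm_eq hz.2⟩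

theorem length_tessTraversal (k w m : ℕ) (i : ℤ) : (tessTraversal k w m i).length =
    ((tessPoints k w m).filter fun z => tessForm k z = i * ballSize k).card := by
  rw [tessTraversal, List.length_map, Finset.length_sort, Finset.card_image_of_injOn]
  intro u hu v hv huv
  rw [← eq_of_tessForm_eq (Finset.mem_filter.1 hu).2,
    ← eq_of_tessForm_eq (Finset.mem_filter.1 hv).2]
  rw [show u.1 = v.1 from huv]

theorem tessTraversal_pairwise (k w m : ℕ) (i : ℤ) :
    (tessTraversal k w m i).Pairwise fun u v => u.1 < v.1 := by
  rw [tessTraversal, List.pairwise_map]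
  exact (Finset.sortedLT_sort _).pairwise

theorem tessForm_add (k : ℕ) (z : ℤ × ℤ) : tessForm k (z.1 + (k + 1), z.2 - k) = tessForm k z := by
  simp only [tessForm]; ring

theorem tessForm_sub (k : ℕ) (z : ℤ × ℤ) : tessForm k (z.1 - (k + 1), z.2 + k) = tessForm k z := by
  simp only [tessForm]; ring

/-- A rotated traversal can only leave the vicinity of the rectangle below or on the right. -/
theorem right_end_of_not_mem {k w m : ℕ} {z : ℤ × ℤ} (hz : z ∈ tessPoints k w m)
    (h : (z.1 + (k + 1), z.2 - k) ∉ tessPoints k w m) : z.2 < 0 ∨ (w : ℤ) - k ≤ z.1 := by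
  rw [mem_tessPoints, tessForm_add] at h
  rw [mem_tessPoints] at hz
  have h2 : ¬ _ := fun h3 => h ⟨hz.1, h3⟩
  have h4 := hz.2
  dsimp only at h2
  omega

/-- A rotated traversal can only enter the vicinity of the rectangle above or on the left. -/
theorem left_end_of_not_mem {k w m : ℕ} {z : ℤ × ℤ} (hz : z ∈ tessPoints k w m)
    (h : (z.1 - (k + 1), z.2 + k) ∉ tessPoints k w m) : (m : ℤ) < z.2 ∨ z.1 ≤ k := by
  rw [mem_tessPoints, tessForm_sub] at h
  rw [mem_tessPoints] at hz
  have h2 : ¬ _ := fun h3 => h ⟨hz.1, h3⟩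
  have h4 := hz.2
  dsimp only at h2
  omega

/-- Between two of its chosen points, a rotated traversal does not leave the vicinity of the
rectangle: the distance to the rectangle is a convex function. -/
theorem add_mem_tessPoints {k w m : ℕ} {z z' : ℤ × ℤ} (hz : z ∈ tessPoints k w m)
    (hz' : z' ∈ tessPoints k w m) (h1 : z.1 + (k + 1) ≤ z'.1) (h2 : z'.2 ≤ z.2 - k) :
    (z.1 + (k + 1), z.2 - k) ∈ tessPoints k w m := by
  rw [mem_tessPoints] at hz hz' ⊢
  rw [tessForm_add]
  refine ⟨hz.1, ?_⟩
  have h3 := hz.2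
  have h4 := hz'.2
  dsimp only
  omega

theorem le_of_tessForm_eq {k : ℕ} {z z' : ℤ × ℤ} (h : tessForm k z = tessForm k z')
    (hlt : z.1 < z'.1) : z.1 + (k + 1) ≤ z'.1 ∧ z'.2 ≤ z.2 - k := by
  simp only [tessForm] at h
  have h1 : (k : ℤ) * (z'.1 - z.1) = (k + 1) * (z.2 - z'.2) := by linarith
  have h2 : z'.1 - z.1 = (k + 1) * ((z'.1 - z.1) - (z.2 - z'.2)) := by linarith
  have h3 : z.2 - z'.2 = k * ((z'.1 - z.1) - (z.2 - z'.2)) := by linarith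
  generalize (z'.1 - z.1) - (z.2 - z'.2) = e at *
  have hk : (0 : ℤ) ≤ k := by positivity
  have he : 1 ≤ e := by
    by_contra hc
    nlinarith
  constructor <;> nlinarith

/-- A list of points with increasing abscissae on a line `tessForm k z = c` without gaps has
consecutive points at distance `2k + 1`. -/
theorem routeLen_le_of_no_gaps {k : ℕ} {c : ℤ} : ∀ l : List (ℤ × ℤ),
    (l.Pairwise fun u v => u.1 < v.1) → (∀ z ∈ l, tessForm k z = c) →
    (∀ z ∈ l, ∀ z' ∈ l, z.1 < z'.1 → (z.1 + (k + 1), z.2 - k) ∈ l) →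
    routeLen l ≤ (2 * k + 1) * l.length
  | [], _, _, _ => by simp [routeLen]
  | [_], _, _, _ => by simp only [routeLen]; positivity
  | x :: y :: l, h1, h2, h3 => by
    have hxy := (List.pairwise_cons.1 h1).1
    have hyl := (List.pairwise_cons.1 (List.pairwise_cons.1 h1).2).1
    have hk : (0 : ℤ) ≤ k := by positivity
    have ih := routeLen_le_of_no_gaps (k := k) (c := c) (y :: l) (List.pairwise_cons.1 h1).2
      (fun z hz => h2 z (List.mem_cons_of_mem _ hz)) (by
        intro z hz z' hz' hlt
        rcases List.mem_cons.1 (h3 z (List.mem_cons_of_mem _ hz) z' (List.mem_cons_of_mem _ hz')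
          hlt) with h | h
        · have h4 := hxy z hz
          rw [← h] at h4
          dsimp only at h4
          omega
        · exact h)
    have hx2 := h2 x (by simp)
    have hy2 := h2 y (by simp)
    obtain ⟨h4, h5⟩ := le_of_tessForm_eq (hx2.trans hy2.symm) (hxy y (by simp))
    have h6 := h3 x (by simp) y (by simp) (hxy y (by simp))
    have h7 : y.1 ≤ x.1 + (k + 1) := by
      rcases List.mem_cons.1 h6 with h | h
      · have := congrArg Prod.fst h
        dsimp only at this
        omega
      · rcases List.mem_cons.1 h with h | h
        · rw [← h]
        · exact (hyl _ h).le
    have h8 : y.2 = x.2 - k := by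
      have h9 : y.1 = x.1 + (k + 1) := le_antisymm h7 h4
      simp only [tessForm] at hx2 hy2
      rw [h9] at hy2
      have h10 : ((k : ℤ) + 1) * y.2 = (k + 1) * (x.2 - k) := by linarith
      exact mul_left_cancel₀ (by positivity) h10
    have h9 : l1Dist x y = 2 * k + 1 := by
      simp only [l1Dist, abs_eq_max_neg]; omega
    simp only [routeLen, List.length_cons] at ih ⊢
    rw [h9]
    push_cast at ih ⊢
    linarith

theorem routeLen_tessTraversal_le (k w m : ℕ) (i : ℤ) :
    routeLen (tessTraversal k w m i) ≤ (2 * k + 1) * (tessTraversal k w m i).length := by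
  refine routeLen_le_of_no_gaps (c := i * ballSize k) _ (tessTraversal_pairwise k w m i)
    (fun z hz => (mem_tessTraversal.1 hz).2) ?_
  intro z hz z' hz' hlt
  rw [mem_tessTraversal] at hz hz' ⊢
  obtain ⟨h1, h2⟩ := le_of_tessForm_eq (hz.2.trans hz'.2.symm) hlt
  exact ⟨add_mem_tessPoints hz.1 hz'.1 h1 h2, by rw [tessForm_add]; exact hz.2⟩

/-- If `tessForm k` increases by `e * ballSize k` from `u` to `v`, while neither coordinate drops
by more than `2k`, then the distance is `O(k e)`. The drops are controlled if, for each coordinate,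
either this one drops little or the other one grows little. -/
theorem l1Dist_le_of_tessForm_sub {k : ℕ} {e : ℤ} {u v : ℤ × ℤ} (he : 1 ≤ e)
    (h : tessForm k v - tessForm k u = e * ballSize k) (hk : 1 ≤ k)
    (h1 : -2 * (k : ℤ) ≤ v.1 - u.1 ∨ v.2 - u.2 ≤ k)
    (h2 : -2 * (k : ℤ) ≤ v.2 - u.2 ∨ v.1 - u.1 ≤ 2 * k) :
    l1Dist u v ≤ 18 * k * e := by
  have hform : k * (v.1 - u.1) + (k + 1) * (v.2 - u.2) = e * (2 * (k : ℤ) ^ 2 + 2 * k + 1) := by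
    rw [← ballSize_cast, ← h]; simp only [tessForm]; ring
  have hk' : (1 : ℤ) ≤ k := by exact_mod_cast hk
  rw [l1Dist_comm, l1Dist]
  generalize v.1 - u.1 = x at *
  generalize v.2 - u.2 = y at *
  generalize (k : ℤ) = K at *
  have hke : K ≤ K * e := by nlinarith
  have hkke : K * K ≤ K * (K * e) := by nlinarith
  have hx : -2 * K ≤ x := by
    rcases h1 with h1 | h1
    · exact h1
    · by_contra hc
      nlinarith
  have hy : -2 * K ≤ y := by
    rcases h2 with h2 | h2
    · exact h2
    · by_contra hc
      nlinarith
  have hx2 : x ≤ 9 * (K * e) := by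
    refine le_of_mul_le_mul_left (a := K) ?_ (by linarith)
    nlinarith
  have hy2 : y ≤ 9 * (K * e) := by
    refine le_of_mul_le_mul_left (a := K + 1) ?_ (by linarith)
    nlinarith
  have h3 : |x| ≤ 9 * (K * e) := abs_le.2 ⟨by linarith, hx2⟩
  have h4 : |y| ≤ 9 * (K * e) := abs_le.2 ⟨by linarith, hy2⟩
  linarith

theorem rel_of_mem_getLast? {α : Type*} {r : α → α → Prop} {x : α} {l : List α} (hl : l.Pairwise r)
    (hx : x ∈ l.getLast?) {y : α} (hy : y ∈ l) : y = x ∨ r y x := by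
  obtain ⟨l', rfl⟩ := List.mem_getLast?_eq_getLast hx |>.elim fun h1 h2 =>
    (⟨l.dropLast, by rw [h2, List.dropLast_append_getLast]⟩ : ∃ l', l = l' ++ [x])
  rcases List.mem_append.1 hy with h | h
  · exact Or.inr ((List.pairwise_append.1 hl).2.2 y h x (by simp))
  · exact Or.inl (by simpa using h)

theorem rel_of_mem_head? {α : Type*} {r : α → α → Prop} {x : α} {l : List α} (hl : l.Pairwise r)
    (hx : x ∈ l.head?) {y : α} (hy : y ∈ l) : y = x ∨ r x y := by
  cases l with
  | nil => simp at hx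
  | cons a l =>
    obtain rfl : a = x := by simpa using hx
    rcases List.mem_cons.1 hy with h | h
    · exact Or.inl h
    · exact Or.inr ((List.pairwise_cons.1 hl).1 y h)

theorem tessTraversal_last_dist {k w m : ℕ} (hk : 1 ≤ k) {i j : ℤ} (hij : i < j) {u v : ℤ × ℤ}
    (hu : u ∈ (tessTraversal k w m i).getLast?) (hv : v ∈ (tessTraversal k w m j).getLast?) :
    l1Dist u v ≤ 18 * k * (j - i) := by
  have key : ∀ {i : ℤ} {u : ℤ × ℤ}, u ∈ (tessTraversal k w m i).getLast? →
      u ∈ tessPoints k w m ∧ tessForm k u = i * ballSize k ∧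
        (u.2 < 0 ∨ (w : ℤ) - k ≤ u.1) := by
    intro i u hu
    obtain ⟨h1, h2⟩ := mem_tessTraversal.1 (List.mem_of_getLast? hu)
    refine ⟨h1, h2, right_end_of_not_mem h1 fun h3 => ?_⟩
    have h4 := rel_of_mem_getLast? (tessTraversal_pairwise k w m i) hu
      (mem_tessTraversal.2 ⟨h3, (tessForm_add k u).trans h2⟩)
    rw [Prod.ext_iff] at h4
    dsimp only at h4
    omega
  obtain ⟨hu1, hu2, hu3⟩ := key hu
  obtain ⟨hv1, hv2, hv3⟩ := key hv
  have hu4 := (mem_tessPoints.1 hu1).2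
  have hv4 := (mem_tessPoints.1 hv1).2
  refine l1Dist_le_of_tessForm_sub (by omega) (by rw [hu2, hv2]; ring) hk ?_ ?_ <;> omega

theorem tessTraversal_head_dist {k w m : ℕ} (hk : 1 ≤ k) {i j : ℤ} (hij : i < j) {u v : ℤ × ℤ}
    (hu : u ∈ (tessTraversal k w m i).head?) (hv : v ∈ (tessTraversal k w m j).head?) :
    l1Dist u v ≤ 18 * k * (j - i) := by
  have key : ∀ {i : ℤ} {u : ℤ × ℤ}, u ∈ (tessTraversal k w m i).head? →
      u ∈ tessPoints k w m ∧ tessForm k u = i * ballSize k ∧ ((m : ℤ) < u.2 ∨ u.1 ≤ k) := by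
    intro i u hu
    obtain ⟨h1, h2⟩ := mem_tessTraversal.1 (List.mem_of_head? hu)
    refine ⟨h1, h2, left_end_of_not_mem h1 fun h3 => ?_⟩
    have h4 := rel_of_mem_head? (tessTraversal_pairwise k w m i) hu
      (mem_tessTraversal.2 ⟨h3, (tessForm_sub k u).trans h2⟩)
    rw [Prod.ext_iff] at h4
    dsimp only at h4
    omega
  obtain ⟨hu1, hu2, hu3⟩ := key hu
  obtain ⟨hv1, hv2, hv3⟩ := key hv
  have hu4 := (mem_tessPoints.1 hu1).2
  have hv4 := (mem_tessPoints.1 hv1).2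
  refine l1Dist_le_of_tessForm_sub (by omega) (by rw [hu2, hv2]; ring) hk ?_ ?_ <;> omega

theorem routeLen_reverse_le : ∀ l : List (ℤ × ℤ), routeLen l.reverse ≤ routeLen l
  | [] => le_rfl
  | [_] => le_rfl
  | x :: y :: l => by
    have ih := routeLen_reverse_le (y :: l)
    rw [List.reverse_cons]
    refine (routeLen_append_le (l1Dist_nonneg x y) [x] _ ?_).trans ?_
    · intro a ha b hb
      rw [List.getLast?_reverse] at ha
      simp only [List.head?_cons, Option.mem_def, Option.some.injEq] at ha hb
      rw [← ha, ← hb, l1Dist_comm]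
    · simp only [routeLen]
      linarith

/-- Blocks that are run through in alternating directions: if the last points of the blocks `i < j`,
and also their first points, are at distance at most `D * (j - i)`, then the connections between
consecutive blocks telescope. -/
theorem routeLen_alternating_le (T : ℤ → List (ℤ × ℤ)) {c D b : ℤ} (hD : 0 ≤ D)
    (hT : ∀ i, routeLen (T i) ≤ c * (T i).length)
    (hlast : ∀ i j, i < j → ∀ u ∈ (T i).getLast?, ∀ v ∈ (T j).getLast?, l1Dist u v ≤ D * (j - i))
    (hhead : ∀ i j, i < j → ∀ u ∈ (T i).head?, ∀ v ∈ (T j).head?, l1Dist u v ≤ D * (j - i)) :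
    ∀ (I : List ℤ) (i : ℤ) (s : ℕ), (i :: I).Pairwise (· < ·) → (∀ j ∈ i :: I, T j ≠ []) →
      (∀ j ∈ i :: I, j ≤ b) →
      routeLen ((i :: I).mapIdx fun j i =>
        if Even (j + s) then T i else (T i).reverse).flatten ≤
        c * ((i :: I).map fun i => ((T i).length : ℤ)).sum + D * (b - i)
  | [], i, s, _, _, hb => by
    have hbi := hb i (by simp)
    have h1 : 0 ≤ D * (b - i) := mul_nonneg hD (by linarith)
    have h2 := hT i
    have h3 := routeLen_reverse_le (T i)
    simp only [List.mapIdx_cons, List.mapIdx_nil, List.flatten_cons, List.flatten_nil,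
      List.append_nil, List.map_cons, List.map_nil, List.sum_cons, List.sum_nil, add_zero]
    split_ifs <;> linarith
  | i' :: I, i, s, hsort, hne, hb => by
    have ih := routeLen_alternating_le T hD hT hlast hhead I i' (s + 1)
      (List.pairwise_cons.1 hsort).2 (fun j hj => hne j (List.mem_cons_of_mem _ hj))
      (fun j hj => hb j (List.mem_cons_of_mem _ hj))
    have hlt : i < i' := (List.pairwise_cons.1 hsort).1 i' (by simp)
    have hne' : T i' ≠ [] := hne i' (by simp)
    have h2 := hT i
    have h3 := routeLen_reverse_le (T i)
    rw [List.mapIdx_cons, List.flatten_cons, List.map_cons, List.sum_cons]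
    have hfun : (fun j i => if Even (j + 1 + s) then T i else (T i).reverse) =
        fun (j : ℕ) i => if Even (j + (s + 1)) then T i else (T i).reverse := by
      funext j i; rw [add_assoc, add_comm 1 s]
    rw [hfun]
    refine (routeLen_append_le (D := D * (i' - i)) (mul_nonneg hD (by linarith)) _ _ ?_).trans ?_
    · intro x hx y hy
      rw [List.mapIdx_cons, List.flatten_cons] at hy
      rcases Nat.even_or_odd s with hs | hs
      · have hs2 : ¬ Even (0 + (s + 1)) := by simpa [Nat.even_add_one] using hs
        rw [if_neg hs2, List.head?_append_of_ne_nil _ (by simpa using hne'),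
          List.head?_reverse] at hy
        rw [if_pos (by simpa using hs)] at hx
        exact hlast i i' hlt x hx y hy
      · have hs2 : Even (0 + (s + 1)) := by simpa [Nat.even_add_one] using hs
        rw [if_pos hs2, List.head?_append_of_ne_nil _ hne'] at hy
        rw [if_neg (by simpa using hs), List.getLast?_reverse] at hx
        exact hhead i i' hlt x hx y hy
    · have h4 : D * (i' - i) + D * (b - i') = D * (b - i) := by ring
      split_ifs <;> linarith

theorem mem_tessIndices {k w m : ℕ} {i : ℤ} : i ∈ tessIndices k w m ↔
    ∃ z ∈ tessPoints k w m, tessForm k z = i * ballSize k := by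
  have hp : (ballSize k : ℤ) ≠ 0 := by exact_mod_cast (ballSize_pos k).ne'
  simp only [tessIndices, Finset.mem_sort, Finset.mem_image]
  refine exists_congr fun z => and_congr_right fun hz => ?_
  rw [Int.ediv_eq_iff_eq_mul_left hp (mem_tessPoints.1 hz).1]

theorem sum_length_tessTraversal (k w m : ℕ) :
    ((tessIndices k w m).map fun i => ((tessTraversal k w m i).length : ℤ)).sum =
      (tessPoints k w m).card := by
  have hp : (ballSize k : ℤ) ≠ 0 := by exact_mod_cast (ballSize_pos k).ne'
  rw [tessIndices, ← List.sum_toFinset _ (Finset.sort_nodup _ _), Finset.sort_toFinset,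
    Finset.card_eq_sum_card_image (fun z => tessForm k z / (ballSize k : ℤ)) (tessPoints k w m)]
  push_cast
  refine Finset.sum_congr rfl fun i _ => ?_
  rw [length_tessTraversal]
  congr 2
  refine Finset.filter_congr fun z hz => ?_
  rw [Int.ediv_eq_iff_eq_mul_left hp (mem_tessPoints.1 hz).1]

/-! ### The zigzag path and the mixed path -/

theorem projectGrid_mem (w m : ℕ) (z : ℤ × ℤ) : projectGrid w m z ∈ gridPoints w m := by
  rw [mem_gridPoints]; simp only [projectGrid]; omega

theorem l1Dist_projectGrid_le (w m : ℕ) (u v : ℤ × ℤ) :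
    l1Dist (projectGrid w m u) (projectGrid w m v) ≤ l1Dist u v := by
  simp only [projectGrid, l1Dist, abs_eq_max_neg]; omega

theorem projectGrid_eq_self {w m : ℕ} {z : ℤ × ℤ} (hz : z ∈ gridPoints w m) :
    projectGrid w m z = z := by
  rw [mem_gridPoints] at hz
  ext <;> simp only [projectGrid] <;> omega

theorem mem_zigzagList {k w m : ℕ} {z : ℤ × ℤ} : z ∈ zigzagList k w m ↔
    ∃ y ∈ tessPoints k w m, projectGrid w m y = z := by
  simp only [zigzagList, List.mem_map, List.mem_flatten, List.mem_mapIdx]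
  refine exists_congr fun y => and_congr_left fun _ => ?_
  constructor
  · rintro ⟨_, ⟨j, hj, rfl⟩, hy⟩
    split_ifs at hy
    · exact (mem_tessTraversal.1 hy).1
    · exact (mem_tessTraversal.1 (List.mem_reverse.1 hy)).1
  · intro hy
    obtain ⟨i, hi⟩ := (mem_tessPoints.1 hy).1
    have hi' : tessForm k y = i * ballSize k := by rw [hi, mul_comm]
    obtain ⟨j, hj, rfl⟩ := List.getElem_of_mem (mem_tessIndices.2 ⟨y, hy, hi'⟩)
    have hmem := mem_tessTraversal.2 ⟨hy, hi'⟩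
    refine ⟨_, ⟨j, hj, rfl⟩, ?_⟩
    split_ifs
    · exact hmem
    · exact List.mem_reverse.2 hmem

theorem zigzagPlan_covers {k w m : ℕ} {z : ℤ × ℤ} (hz : z ∈ gridPoints w m) :
    ∃ s ∈ (zigzagPlan k w m).stops, l1Dist s z ≤ k := by
  obtain ⟨y, hy1, hy2⟩ := exists_tess_near k z
  have hy : y ∈ tessPoints k w m := by
    have hz' := mem_gridPoints.1 hz
    simp only [l1Dist, abs_eq_max_neg] at hy2
    exact mem_tessPoints.2 ⟨hy1, by omega⟩
  refine ⟨_, List.mem_toFinset.2 (mem_zigzagList.2 ⟨y, hy, rfl⟩), ?_⟩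
  have h1 := l1Dist_projectGrid_le w m y z
  rw [projectGrid_eq_self hz] at h1
  exact h1.trans hy2

theorem zigzagPlan_isCovering (k w m : ℕ) : IsCoveringPlan k w m (zigzagPlan k w m) where
  waypoints_ne_nil := by
    intro h
    obtain ⟨s, hs, -⟩ := zigzagPlan_covers (k := k) (w := w) (m := m) (z := (0, 0))
      (mem_gridPoints.2 (by dsimp only; omega))
    have hs' : s ∈ zigzagList k w m := List.mem_toFinset.1 hs
    rw [show zigzagList k w m = [] from h] at hs'
    simp at hs'
  waypoints_mem := by
    intro z hz
    obtain ⟨y, -, rfl⟩ := mem_zigzagList.1 hz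
    exact projectGrid_mem w m y
  stops_mem := by
    intro z hz
    obtain ⟨y, -, rfl⟩ := mem_zigzagList.1 (List.mem_toFinset.1 hz)
    exact projectGrid_mem w m y
  stops_visited := fun s hs => Or.inl (List.mem_toFinset.1 hs)
  covers := fun _ hz => zigzagPlan_covers hz

theorem card_zigzagPlan_stops_le (k w m : ℕ) :
    (zigzagPlan k w m).stops.card ≤ (tessPoints k w m).card := by
  refine (Finset.card_le_card (t := (tessPoints k w m).image (projectGrid w m)) ?_).trans
    Finset.card_image_le
  intro z hz
  exact Finset.mem_image.2 (mem_zigzagList.1 (List.mem_toFinset.1 hz))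

theorem routeLen_zigzagPlan_le {k : ℕ} (w m : ℕ) (hk : 1 ≤ k) :
    routeLen (zigzagPlan k w m).waypoints ≤
      (2 * k + 1) * (tessPoints k w m).card + 18 * (w + m + 4 * k) := by
  refine (routeLen_map_le (l1Dist_projectGrid_le w m) _).trans ?_
  have hk' : (1 : ℤ) ≤ k := by exact_mod_cast hk
  have hrange : ∀ i ∈ tessIndices k w m, ∀ j ∈ tessIndices k w m,
      (k : ℤ) * (j - i) ≤ w + m + 4 * k := by
    intro i hi j hj
    obtain ⟨u, hu, hu2⟩ := mem_tessIndices.1 hi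
    obtain ⟨v, hv, hv2⟩ := mem_tessIndices.1 hj
    have hu3 := (mem_tessPoints.1 hu).2
    have hv3 := (mem_tessPoints.1 hv).2
    have hx : v.1 - u.1 ≤ w + 2 * k := by omega
    have hy : v.2 - u.2 ≤ m + 2 * k := by omega
    have hform : (k : ℤ) * (v.1 - u.1) + (k + 1) * (v.2 - u.2) =
        (j - i) * (2 * (k : ℤ) ^ 2 + 2 * k + 1) := by
      rw [← ballSize_cast, sub_mul, ← hu2, ← hv2]; simp only [tessForm]; ring
    have hm : (0 : ℤ) ≤ m := by positivity
    have hw : (0 : ℤ) ≤ w := by positivity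
    by_contra hc
    push Not at hc
    have he : 0 < j - i := by
      by_contra he
      nlinarith
    have h1 : 2 * (k : ℤ) * (w + m + 4 * k) < 2 * k * (k * (j - i)) :=
      mul_lt_mul_of_pos_left hc (by linarith)
    nlinarith [mul_le_mul_of_nonneg_left hx (show (0 : ℤ) ≤ k by linarith),
      mul_le_mul_of_nonneg_left hy (show (0 : ℤ) ≤ k + 1 by linarith),
      mul_le_mul_of_nonneg_right hk' hm]
  have hsum := sum_length_tessTraversal k w m
  have hsort : (tessIndices k w m).Pairwise (· < ·) := (Finset.sortedLT_sort _).pairwise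
  have hne : ∀ i ∈ tessIndices k w m, tessTraversal k w m i ≠ [] := by
    intro i hi
    obtain ⟨z, hz1, hz2⟩ := mem_tessIndices.1 hi
    exact List.ne_nil_of_mem (mem_tessTraversal.2 ⟨hz1, hz2⟩)
  rcases hI : tessIndices k w m with _ | ⟨i, I⟩
  · simp only [List.mapIdx_nil, List.flatten_nil, routeLen]
    positivity
  · rw [hI] at hsum hsort hne hrange
    obtain ⟨b, hb, hbmax⟩ := Finset.exists_max_image (i :: I).toFinset id ⟨i, by simp⟩
    have h1 := routeLen_alternating_le (tessTraversal k w m) (c := 2 * k + 1) (D := 18 * k)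
      (b := b) (by positivity) (routeLen_tessTraversal_le k w m)
      (fun i j hij u hu v hv => tessTraversal_last_dist hk hij hu hv)
      (fun i j hij u hu v hv => tessTraversal_head_dist hk hij hu hv) I i 0 hsort hne
      (fun j hj => hbmax j (List.mem_toFinset.2 hj))
    simp only [add_zero] at h1
    rw [hsum] at h1
    have h2 := hrange i (by simp) b (List.mem_toFinset.1 hb)
    linarith

/-- The types of the discrete up-and-down paths, with the zigzag path. -/
def IsPathType (k t : ℕ) : Prop := IsUpDownType k t ∨ t = 2 * k + 1

theorem fUB_of_isUpDownType {k t : ℕ} (ht : IsUpDownType k t) :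
    fUB k t = t * separation k t := by
  rcases ht with rfl | ⟨h, rfl, h1, h2⟩
  · simp [fUB, separation]
  · have h3 : 2 * h ≠ 1 := by omega
    have h4 : 2 * h ≤ 2 * k := by omega
    rw [fUB, if_neg h3, if_pos h4, separation, if_neg h3, Nat.mul_div_cancel_left _ (by norm_num),
      Nat.cast_sub (by omega)]
    push_cast; ring

theorem fUB_top {k : ℕ} (hk : 1 ≤ k) : fUB k (2 * k + 1) = ballSize k := by
  rw [fUB, if_neg (by omega), if_neg (by omega)]
  simp [ballSize]

theorem IsPathType.pos {k t : ℕ} (ht : IsPathType k t) : 1 ≤ t := by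
  rcases ht with (rfl | ⟨h, rfl, h1, h2⟩) | rfl <;> omega

theorem le_fUB {k t : ℕ} (hk : 1 ≤ k) (ht : IsPathType k t) : (t : ℝ) ≤ fUB k t := by
  rcases ht with ht | rfl
  · rw [fUB_of_isUpDownType ht]
    have : (1 : ℝ) ≤ separation k t := by exact_mod_cast separation_pos k t ht
    nlinarith [(Nat.cast_nonneg t : (0 : ℝ) ≤ t)]
  · rw [fUB_top hk]
    have : 2 * k + 1 ≤ ballSize k := by unfold ballSize; omega
    exact_mod_cast this

theorem fUB_le {k t : ℕ} (hk : 1 ≤ k) (ht : IsPathType k t) : fUB k t ≤ t * (2 * k + 1) := by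
  rcases ht with ht | rfl
  · rw [fUB_of_isUpDownType ht]
    have h1 : separation k t ≤ 2 * k + 1 := by unfold separation; split_ifs <;> omega
    have h2 : (separation k t : ℝ) ≤ 2 * k + 1 := by exact_mod_cast h1
    exact mul_le_mul_of_nonneg_left h2 (by positivity)
  · rw [fUB_top hk]
    have : ballSize k ≤ (2 * k + 1) * (2 * k + 1) := by unfold ballSize; nlinarith
    exact_mod_cast this

/-- A path of type `t` on a strip of width `w` visits, up to boundary effects, one stop for every
`fUB k t` points, at distance `t` from the previous one. -/
theorem discretePlan_bounds {k w m t : ℕ} (hk : 1 ≤ k) (hw : 1 ≤ w) (hwm : w ≤ m)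
    (hm : 2 * k + 1 ≤ m) (ht : IsPathType k t) :
    IsCoveringPlan k w m (discretePlan k t w m) ∧
      (routeLen (discretePlan k t w m).waypoints : ℝ) ≤ w * m * (t / fUB k t) + 88 * m ∧
      ((discretePlan k t w m).stops.card : ℝ) ≤ w * m * (1 / fUB k t) + 16 * (m / t) := by
  have hk' : (1 : ℝ) ≤ k := by exact_mod_cast hk
  have hwm' : (w : ℝ) ≤ m := by exact_mod_cast hwm
  have hm' : 2 * (k : ℝ) + 1 ≤ m := by exact_mod_cast hm
  have hw0 : (0 : ℝ) ≤ w := by positivity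
  rcases ht with ht | rfl
  · have htne : t ≠ 2 * k + 1 := by rcases ht with rfl | ⟨h, rfl, h1, h2⟩ <;> omega
    rw [discretePlan, if_neg htne]
    have ht1 : 1 ≤ t := IsPathType.pos (Or.inl ht)
    have htk : t ≤ 2 * k := by rcases ht with rfl | ⟨h, rfl, h1, h2⟩ <;> omega
    have hts : t ≤ 2 * separation k t := by
      rcases ht with rfl | ⟨h, rfl, h1, h2⟩
      · rw [separation, if_pos rfl]; omega
      · rw [separation, if_neg (by omega)]; omega
    have hs := separation_pos k t ht
    have ht0 : (0 : ℝ) < t := by exact_mod_cast ht1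
    have hs0 : (0 : ℝ) < separation k t := by exact_mod_cast hs
    have htk' : (t : ℝ) ≤ 2 * k := by exact_mod_cast htk
    have hts' : (t : ℝ) ≤ 2 * separation k t := by exact_mod_cast hts
    refine ⟨upDownPlan_isCovering m ht hw, (routeLen_upDownPlan_le w m ht).trans ?_,
      (card_upDownPlan_stops_le w m ht).trans ?_⟩ <;> rw [fUB_of_isUpDownType ht]
    · rw [div_mul_cancel_left₀ ht0.ne', ← div_eq_mul_inv]
      linarith
    · have h1 : (w : ℝ) / separation k t ≤ 2 * (m / t) := by
        rw [← mul_div_assoc, div_le_div_iff₀ hs0 ht0]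
        nlinarith
      have h2 : 1 ≤ (m : ℝ) / t := by rw [one_le_div ht0]; linarith
      have h3 : (w : ℝ) / separation k t * (m / t) = w * m * (1 / (t * separation k t)) := by
        field_simp
      nlinarith
  · rw [discretePlan, if_pos rfl, fUB_top hk]
    have hp : (0 : ℝ) < ballSize k := by exact_mod_cast ballSize_pos k
    have hcard : ((tessPoints k w m).card : ℝ) * ballSize k ≤
        (w + 4 * k + 1) * (m + 4 * k + 1) := by
      exact_mod_cast card_tessPoints_mul_le k w m
    have h1 : (2 * (k : ℝ) + 1) * (4 * k + 1) ≤ 4 * ballSize k := by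
      simp only [ballSize]; push_cast; nlinarith
    have h2 : (2 * (k : ℝ) + 1) * (tessPoints k w m).card ≤
        w * m * ((2 * k + 1) / ballSize k) + 16 * m := by
      rw [← mul_le_mul_iff_left₀ hp]
      have h3 : (w * m * ((2 * (k : ℝ) + 1) / ballSize k) + 16 * m) * ballSize k =
          w * m * (2 * k + 1) + 16 * m * ballSize k := by field_simp
      rw [h3]
      have h4 := mul_le_mul_of_nonneg_left hcard (show (0 : ℝ) ≤ 2 * k + 1 by linarith)
      have h5 := mul_le_mul_of_nonneg_right h1 (show (0 : ℝ) ≤ w + m + 4 * k + 1 by linarith)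
      have h6 := mul_le_mul_of_nonneg_left (show (w : ℝ) + m + 4 * k + 1 ≤ 4 * m by linarith) hp.le
      nlinarith
    refine ⟨zigzagPlan_isCovering k w m, ?_, ?_⟩
    · have h3 : (routeLen (zigzagPlan k w m).waypoints : ℝ) ≤
          (2 * k + 1) * (tessPoints k w m).card + 18 * (w + m + 4 * k) := by
        exact_mod_cast routeLen_zigzagPlan_le w m hk
      push_cast
      linarith
    · have h3 : ((zigzagPlan k w m).stops.card : ℝ) ≤ (tessPoints k w m).card := by
        exact_mod_cast card_zigzagPlan_stops_le k w m
      refine h3.trans ?_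
      have h4 : (0 : ℝ) < 2 * k + 1 := by linarith
      rw [← mul_le_mul_iff_right₀ h4]
      refine h2.trans (le_of_eq ?_)
      push_cast
      field_simp

theorem mixedPlanAt_bounds {k n m l r : ℕ} {γ : ℝ} (hk : 1 ≤ k) (hn : 1 ≤ n) (hnm : n ≤ m)
    (hm : 2 * k + 1 ≤ m) (hl : IsPathType k l) (hr : IsPathType k r) (hlr : l ≤ r)
    (hγ0 : 0 ≤ γ) (hγ1 : γ ≤ 1) :
    IsCoveringPlan k n m (mixedPlanAt k n m l r ⌈γ * n⌉₊) ∧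
      (routeLen (mixedPlanAt k n m l r ⌈γ * n⌉₊).waypoints : ℝ) ≤
        n * m * (γ * (l / fUB k l) + (1 - γ) * (r / fUB k r)) + 179 * m ∧
      ((mixedPlanAt k n m l r ⌈γ * n⌉₊).stops.card : ℝ) ≤
        n * m * (γ * (1 / fUB k l) + (1 - γ) * (1 / fUB k r)) + 33 * (m / l) := by
  have hn0 : (0 : ℝ) < n := by exact_mod_cast hn
  have hnm' : (n : ℝ) ≤ m := by exact_mod_cast hnm
  have hl1 : (1 : ℝ) ≤ l := by exact_mod_cast hl.pos
  have hr1 : (1 : ℝ) ≤ r := by exact_mod_cast hr.pos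
  have hlr' : (l : ℝ) ≤ r := by exact_mod_cast hlr
  have hfl := le_fUB hk hl
  have hfr := le_fUB hk hr
  have hal0 : 0 ≤ (l : ℝ) / fUB k l := div_nonneg (by linarith) (by linarith)
  have har0 : 0 ≤ (r : ℝ) / fUB k r := div_nonneg (by linarith) (by linarith)
  have hbl0 : 0 ≤ 1 / fUB k l := div_nonneg zero_le_one (by linarith)
  have hbr0 : 0 ≤ 1 / fUB k r := div_nonneg zero_le_one (by linarith)
  have hal1 : (l : ℝ) / fUB k l ≤ 1 := (div_le_one (by linarith)).2 hfl
  have hbl1 : (m : ℝ) * (1 / fUB k l) ≤ m / l := by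
    rw [mul_one_div]
    exact div_le_div_of_nonneg_left (by positivity) (by linarith) hfl
  have hmr : (m : ℝ) / r ≤ m / l := div_le_div_of_nonneg_left (by positivity) (by linarith) hlr'
  have hml0 : 0 ≤ (m : ℝ) / l := by positivity
  have hw1 : γ * n ≤ ⌈γ * n⌉₊ := Nat.le_ceil _
  have hw2 : (⌈γ * n⌉₊ : ℝ) < γ * n + 1 := Nat.ceil_lt_add_one (by positivity)
  generalize ⌈γ * n⌉₊ = w at *
  have hm0 : (0 : ℝ) ≤ m := by positivity
  -- a strip of width at most `γ n + 1`
  have boundL : ∀ x a : ℝ, x ≤ γ * n + 1 → 0 ≤ a → x * m * a ≤ n * m * (γ * a) + m * a := by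
    intro x a hx ha
    nlinarith [mul_le_mul_of_nonneg_right hx (mul_nonneg hm0 ha)]
  -- a strip of width at most `(1 - γ) n`
  have boundR : ∀ x a : ℝ, x ≤ (1 - γ) * n → 0 ≤ a → x * m * a ≤ n * m * ((1 - γ) * a) := by
    intro x a hx ha
    nlinarith [mul_le_mul_of_nonneg_right hx (mul_nonneg hm0 ha)]
  have posR : ∀ a : ℝ, 0 ≤ a → 0 ≤ n * m * ((1 - γ) * a) := fun a ha =>
    mul_nonneg (by positivity) (mul_nonneg (by linarith) ha)
  have posL : ∀ a : ℝ, 0 ≤ a → 0 ≤ n * m * (γ * a) := fun a ha => by positivity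
  rw [mul_add, mul_add, mixedPlanAt]
  split_ifs with h0 h1
  · obtain ⟨hc, hL, hT⟩ := discretePlan_bounds hk hn hnm hm hr
    rw [h0, Nat.cast_zero] at hw1
    have hx : (n : ℝ) ≤ (1 - γ) * n := by linarith
    refine ⟨hc, ?_, ?_⟩
    · linarith [boundR n _ hx har0, posL _ hal0]
    · linarith [boundR n _ hx hbr0, posL _ hbl0]
  · obtain ⟨hc, hL, hT⟩ := discretePlan_bounds hk hn hnm hm hl
    have h1' : (n : ℝ) ≤ w := by exact_mod_cast h1
    have hx : (n : ℝ) ≤ γ * n + 1 := by linarith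
    refine ⟨hc, ?_, ?_⟩
    · nlinarith [boundL n _ hx hal0, posR _ har0]
    · linarith [boundL n _ hx hbl0, posR _ hbr0]
  · obtain ⟨w', rfl⟩ := Nat.exists_eq_add_of_le (show w ≤ n by omega)
    rw [Nat.add_sub_cancel_left]
    obtain ⟨hc, hL, hT⟩ := discretePlan_bounds (t := l) (w := w) (m := m) hk (by omega)
      (by omega) hm hl
    obtain ⟨hc', hL', hT'⟩ := discretePlan_bounds (t := r) (w := w') (m := m) hk (by omega)
      (by omega) hm hr
    have hx : (w' : ℝ) ≤ (1 - γ) * (w + w' : ℕ) := by push_cast at hw1 ⊢; linarith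
    have hR := routeLen_append_shift_le hc hc'
    have hR' : (routeLen ((discretePlan k l w m).append
        ((discretePlan k r w' m).shift w)).waypoints : ℝ) ≤
        routeLen (discretePlan k l w m).waypoints + (w + w' + m) +
          routeLen (discretePlan k r w' m).waypoints := by exact_mod_cast hR
    have hS' : (((discretePlan k l w m).append
        ((discretePlan k r w' m).shift w)).stops.card : ℝ) ≤
        (discretePlan k l w m).stops.card + (discretePlan k r w' m).stops.card := by
      exact_mod_cast card_stops_append_shift_le _ _ w
    refine ⟨hc.append_shift hc', ?_, ?_⟩
    · have h5 := boundL w _ hw2.le hal0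
      have h6 := boundR w' _ hx har0
      push_cast at h5 h6 hnm' ⊢
      nlinarith
    · have h5 := boundL w _ hw2.le hbl0
      have h6 := boundR w' _ hx hbr0
      push_cast at h5 h6 ⊢
      linarith

/-! ### Comparison with the relaxed optimum -/

theorem lowerType_cases {k : ℕ} {d : ℝ} (hk : 1 ≤ k) (hd2 : d ≤ 2 * k + 1) :
    (lowerType d = 1 ∧ nextType k (lowerType d) = 2 ∧ d < 2) ∨
    (∃ h, 1 ≤ h ∧ h < k ∧ lowerType d = 2 * h ∧ nextType k (lowerType d) = 2 * h + 2 ∧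
      2 * h ≤ d ∧ d < 2 * h + 2) ∨
    (lowerType d = 2 * k ∧ nextType k (lowerType d) = 2 * k + 1 ∧ 2 * k ≤ d) := by
  by_cases h2 : d < 2
  · left
    have h3 : lowerType d = 1 := if_pos h2
    rw [h3]
    exact ⟨rfl, by simp [nextType], h2⟩
  · right
    have h3 : lowerType d = 2 * ⌊d / 2⌋₊ := if_neg h2
    have h4 : 1 ≤ ⌊d / 2⌋₊ := (Nat.one_le_floor_iff _).2 (by linarith)
    have h5 : (⌊d / 2⌋₊ : ℝ) ≤ d / 2 := Nat.floor_le (by linarith)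
    have h6 : d / 2 < ⌊d / 2⌋₊ + 1 := Nat.lt_floor_add_one _
    have h7 : ⌊d / 2⌋₊ < k + 1 := by
      have : (⌊d / 2⌋₊ : ℝ) < k + 1 := by linarith
      exact_mod_cast this
    rw [h3]
    generalize ⌊d / 2⌋₊ = h at *
    rw [nextType, if_neg (by omega)]
    rcases Nat.lt_succ_iff_lt_or_eq.1 h7 with h8 | rfl
    · exact Or.inl ⟨h, h4, h8, rfl, by omega, by linarith, by linarith⟩
    · exact Or.inr ⟨rfl, by omega, by linarith⟩

theorem fUB_one (k : ℕ) : fUB k 1 = 2 * k + 1 := if_pos rfl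

theorem fUB_two_mul {k h : ℕ} (hk : h ≤ k) : fUB k (2 * h) = 2 * h * (2 * k + 1 - h) := by
  rw [fUB, if_neg (by omega), if_pos (by omega)]
  push_cast; ring

theorem fLBNat_two_mul {k h : ℕ} (hk : h ≤ k) : fLBNat k (2 * h) = 2 * h * (2 * k + 1 - h) := by
  rw [fLBNat, if_pos (by omega), if_neg (by simp)]
  push_cast; ring

/-- Between two even distances, `fLBNat` exceeds its linear interpolation by `1` at the odd
distance in the middle. -/
theorem fLBNat_two_mul_add_one {k h : ℕ} (hk : h < k) :
    fLBNat k (2 * h + 1) = 2 * h * (2 * k + 1 - h) + (2 * k - 2 * h) + 1 := by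
  rw [fLBNat, if_pos (by omega), if_pos (by simp)]
  push_cast; ring

/-- `fLB k` exceeds the linear interpolation of `fUB k` by a factor of at most `11 / 10`, which is
attained for `k = 2` at `3`, where the values are `11` and `10`. -/
theorem fLB_mul_le {k : ℕ} {d : ℝ} (hk : 1 ≤ k) (hd1 : 1 ≤ d) (hd2 : d ≤ 2 * k + 1) :
    ((nextType k (lowerType d) : ℝ) - lowerType d) * fLB k d ≤
      11 / 10 * (fUB k (lowerType d) * (nextType k (lowerType d) - d) +
        fUB k (nextType k (lowerType d)) * (d - lowerType d)) := by
  have hk' : (1 : ℝ) ≤ k := by exact_mod_cast hk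
  have hfloor : ∀ j : ℕ, (j : ℝ) ≤ d → d < j + 1 →
      fLB k d = (j + 1 - d) * fLBNat k j + (d - j) * fLBNat k (j + 1) := by
    intro j h1 h2
    have h3 : ⌊d⌋₊ = j := (Nat.floor_eq_iff (by linarith)).2 ⟨h1, h2⟩
    rw [fLB, h3]
  rcases lowerType_cases hk hd2 with ⟨hl, hr, h1⟩ | ⟨h, hh1, hhk, hl, hr, h1, h2⟩ |
      ⟨hl, hr, h1⟩
  · have h2 := fUB_two_mul hk
    have h3 := fLBNat_two_mul hk
    simp only [mul_one, Nat.cast_one] at h2 h3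
    rw [hr, hl, hfloor 1 (by simpa using hd1) (by norm_num; linarith), fLBNat_one, h3, fUB_one, h2]
    push_cast
    nlinarith
  · have hh1' : (1 : ℝ) ≤ h := by exact_mod_cast hh1
    have hhk' : (h : ℝ) + 1 ≤ k := by exact_mod_cast hhk
    have hf0 := fUB_two_mul hhk.le
    have hf2 : fUB k (2 * h + 2) = 2 * h * (2 * k + 1 - h) + 2 * (2 * k - 2 * h) := by
      rw [show 2 * h + 2 = 2 * (h + 1) by ring, fUB_two_mul hhk]
      push_cast; ring
    have hg0 := fLBNat_two_mul hhk.le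
    have hg1 := fLBNat_two_mul_add_one hhk
    have hg2 : fLBNat k (2 * h + 1 + 1) = 2 * h * (2 * k + 1 - h) + 2 * (2 * k - 2 * h) := by
      rw [show 2 * h + 1 + 1 = 2 * (h + 1) by ring, fLBNat_two_mul hhk]
      push_cast; ring
    have hF : 8 ≤ 2 * (h : ℝ) * (2 * k + 1 - h) := by nlinarith
    have hFG : 10 ≤ 2 * (h : ℝ) * (2 * k + 1 - h) + (2 * k - 2 * h) := by nlinarith
    rw [hr, hl, hf0, hf2]
    generalize 2 * (h : ℝ) * (2 * k + 1 - h) = F at *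
    have hG : 2 ≤ 2 * (k : ℝ) - 2 * h := by linarith
    generalize 2 * (k : ℝ) - 2 * h = G at *
    push_cast
    by_cases h3 : d < 2 * h + 1
    · rw [hfloor (2 * h) (by push_cast; exact h1) (by push_cast; exact h3), hg0, hg1]
      push_cast
      nlinarith [mul_nonneg (show 0 ≤ d - 2 * h by linarith) (show 0 ≤ F + G - 10 by linarith),
        mul_nonneg (show 0 ≤ 2 * h + 1 - d by linarith) (show 0 ≤ F by linarith)]
    · push Not at h3
      rw [hfloor (2 * h + 1) (by push_cast; exact h3) (by push_cast; linarith), hg1, hg2]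
      push_cast
      nlinarith [mul_nonneg (show 0 ≤ d - (2 * h + 1) by linarith) (show 0 ≤ G by linarith)]
  · have htop := fUB_top hk
    have hp : (0 : ℝ) < ballSize k := by exact_mod_cast ballSize_pos k
    rcases hd2.lt_or_eq with h2 | rfl
    · rw [hr, hl, hfloor (2 * k) (by push_cast; exact h1) (by push_cast; exact h2), htop,
        fLBNat_of_lt (show 2 * k < 2 * k + 1 by omega), fUB_two_mul le_rfl, fLBNat_two_mul le_rfl]
      push_cast
      have h3 : 0 ≤ (2 * (k : ℝ) + 1 - d) * (2 * k * (2 * k + 1 - k)) :=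
        mul_nonneg (by linarith) (mul_nonneg (by linarith) (by linarith))
      have h4 : 0 ≤ (d - 2 * k) * ballSize k := mul_nonneg (by linarith) hp.le
      nlinarith
    · rw [hr, hl, fLB_of_le le_rfl, htop]
      push_cast
      nlinarith

theorem lowerType_facts {k : ℕ} {d : ℝ} (hk : 1 ≤ k) (hd1 : 1 ≤ d) (hd2 : d ≤ 2 * k + 1) :
    IsPathType k (lowerType d) ∧ IsPathType k (nextType k (lowerType d)) ∧
      lowerType d < nextType k (lowerType d) ∧ nextType k (lowerType d) ≤ 2 * lowerType d ∧
      (lowerType d : ℝ) ≤ d ∧ d ≤ nextType k (lowerType d) := by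
  rcases lowerType_cases hk hd2 with ⟨hl, hr, h1⟩ | ⟨h, hh1, hhk, hl, hr, h1, h2⟩ |
      ⟨hl, hr, h1⟩ <;> rw [hr, hl]
  · exact ⟨Or.inl (Or.inl rfl), Or.inl (Or.inr ⟨1, rfl, le_rfl, hk⟩), by omega, by omega,
      by simpa using hd1, by push_cast; exact h1.le⟩
  · exact ⟨Or.inl (Or.inr ⟨h, rfl, hh1, hhk.le⟩), Or.inl (Or.inr ⟨h + 1, rfl, by omega, hhk⟩),
      by omega, by omega, by push_cast; exact h1, by push_cast; exact h2.le⟩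
  · exact ⟨Or.inl (Or.inr ⟨k, rfl, hk, le_rfl⟩), Or.inr rfl, by omega, by omega,
      by push_cast; exact h1, by push_cast; exact hd2⟩

/-- The mixed path with average distance `d` uses, up to boundary effects, one stop for every `D`
points, at average distance `d`, where `D` is the linear interpolation of `fUB k` at `d`. -/
theorem mixedPlan_bounds {k n m : ℕ} {d : ℝ} (hk : 1 ≤ k) (hd1 : 1 ≤ d) (hd2 : d ≤ 2 * k + 1)
    (hn : 1 ≤ n) (hnm : n ≤ m) (hm : 2 * k + 1 ≤ m) :
    IsCoveringPlan k n m (mixedPlan k n m d) ∧ ∃ D : ℝ, 0 < D ∧ fLB k d ≤ 11 / 10 * D ∧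
      (routeLen (mixedPlan k n m d).waypoints : ℝ) ≤ (n * m + 537 * k * m) * (d / D) ∧
      ((mixedPlan k n m d).stops.card : ℝ) ≤ (n * m + 198 * k * m) * (1 / D) := by
  obtain ⟨hl, hr, hlr, hrl, hld, hdr⟩ := lowerType_facts hk hd1 hd2
  have hratio := fLB_mul_le hk hd1 hd2
  rw [mixedPlan]
  generalize lowerType d = l at *
  generalize nextType k l = r at *
  have hk' : (1 : ℝ) ≤ k := by exact_mod_cast hk
  have hl1 : (1 : ℝ) ≤ l := by exact_mod_cast hl.pos
  have hlr' : (0 : ℝ) < r - l := by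
    have : (l : ℝ) < r := by exact_mod_cast hlr
    linarith
  have hrl' : (r : ℝ) ≤ 2 * l := by exact_mod_cast hrl
  have hfl := le_fUB hk hl
  have hfr := le_fUB hk hr
  have hfl2 := fUB_le hk hl
  have hfr2 := fUB_le hk hr
  have hfl0 : 0 < fUB k l := by linarith
  have hfr0 : 0 < fUB k r := by linarith
  set E := fUB k l * (r - d) + fUB k r * (d - l) with hE
  have h1 : 0 ≤ fUB k l * (r - d) := mul_nonneg hfl0.le (by linarith)
  have h2 : 0 ≤ fUB k r * (d - l) := mul_nonneg hfr0.le (by linarith)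
  have hE0 : 0 < E := by
    rcases hdr.lt_or_eq with h | h
    · have : 0 < fUB k l * (r - d) := mul_pos hfl0 (by linarith)
      linarith
    · have : 0 < fUB k r * (d - l) := mul_pos hfr0 (by linarith)
      linarith
  have hγ : mixWeight k l r d = fUB k l * (r - d) / E := rfl
  have hγ1 : 1 - mixWeight k l r d = fUB k r * (d - l) / E := by
    rw [hγ, one_sub_div hE0.ne', hE]; ring
  have hγ0 : 0 ≤ mixWeight k l r d := by rw [hγ]; positivity
  have hγ1' : 0 ≤ 1 - mixWeight k l r d := by rw [hγ1]; positivity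
  obtain ⟨hc, hL, hT⟩ := mixedPlanAt_bounds hk hn hnm hm hl hr hlr.le hγ0 (by linarith)
  rw [hγ1] at hL hT
  have hD0 : 0 < E / (r - l) := div_pos hE0 hlr'
  have hLd : mixWeight k l r d * (l / fUB k l) + fUB k r * (d - l) / E * (r / fUB k r) =
      d / (E / (r - l)) := by
    rw [hγ]; field_simp; ring
  have hTd : mixWeight k l r d * (1 / fUB k l) + fUB k r * (d - l) / E * (1 / fUB k r) =
      1 / (E / (r - l)) := by
    rw [hγ]; field_simp; ring
  rw [hLd] at hL
  rw [hTd] at hT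
  have hDd : E / (r - l) ≤ d * (2 * k + 1) := by
    rw [div_le_iff₀ hlr', hE]
    have h3 := mul_le_mul_of_nonneg_right hfl2 (show (0 : ℝ) ≤ r - d by linarith)
    have h4 := mul_le_mul_of_nonneg_right hfr2 (show (0 : ℝ) ≤ d - l by linarith)
    nlinarith
  have hm0 : (0 : ℝ) ≤ m := by positivity
  have hDf : fLB k d ≤ 11 / 10 * (E / (r - l)) := by
    rw [← mul_div_assoc, le_div_iff₀ hlr', mul_comm]
    exact hratio
  refine ⟨hc, E / (r - l), hD0, hDf, hL.trans ?_, hT.trans ?_⟩ <;>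
    generalize E / ((r : ℝ) - l) = D at *
  · -- `D ≤ d (2k + 1) ≤ 3 k d` absorbs the `O(m)` boundary terms
    have h3 : (1 : ℝ) ≤ 3 * k * (d / D) := by
      rw [← mul_div_assoc, one_le_div hD0]
      nlinarith
    linarith [mul_le_mul_of_nonneg_left h3 hm0]
  · have h3 : (m : ℝ) / l ≤ 6 * k * m * (1 / D) := by
      rw [mul_one_div, div_le_div_iff₀ (by linarith) hD0]
      have h4 : d * (2 * k + 1) ≤ (2 * l) * (3 * k) :=
        mul_le_mul (by linarith) (by linarith) (by linarith) (by linarith)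
      linarith [mul_le_mul_of_nonneg_left (hDd.trans h4) hm0]
    linarith

theorem fLB_min {k : ℕ} (d : ℝ) : fLB k (min d (2 * k + 1)) = fLB k d := by
  rcases le_total d (2 * k + 1) with h | h
  · rw [min_eq_left h]
  · rw [min_eq_right h, fLB_of_le le_rfl, fLB_of_le h]

theorem mainTheorem9 :
    ∃ C C' : ℝ, 0 < C ∧ 0 < C' ∧
      ∀ (k m n : ℕ) (ε α β : ℝ), 1 ≤ k → 0 < ε → ε < 1 → 0 ≤ α → 0 ≤ β →
        n ≤ m → C * (k / ε) ≤ n →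
        (∃ q : ℝ × ℝ, IsRelaxedOptimum k n m α β q) ∧
        ∀ q : ℝ × ℝ, IsRelaxedOptimum k n m α β q →
          ∃ (u v : ℤ × ℤ) (P : (gridGraph n m).Walk u v),
            FollowsRoute n m (mixedPlan k n m (targetSpacing k q)).waypoints P ∧
            IsCoveringPath k n m P (mixedPlan k n m (targetSpacing k q)).stops ∧
            ∀ (u' v' : ℤ × ℤ) (Q : (gridGraph n m).Walk u' v') (S : Finset (ℤ × ℤ)),
              IsCoveringPath k n m Q S →
                pathCost α β P (mixedPlan k n m (targetSpacing k q)).stops ≤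
                  (11 / 10 + C' * ε) * pathCost α β Q S := by
  refine ⟨100, 24, by norm_num, by norm_num, ?_⟩
  intro k m n ε α β hk hε0 hε1 hα hβ hnm hn
  have hk' : (1 : ℝ) ≤ k := by exact_mod_cast hk
  have hnm' : (n : ℝ) ≤ m := by exact_mod_cast hnm
  have hkn : 100 * (k : ℝ) ≤ ε * n := by
    rw [← mul_div_assoc, div_le_iff₀ hε0] at hn
    linarith
  have hn0 : (0 : ℝ) ≤ n := by positivity
  have hm0 : (0 : ℝ) ≤ m := by positivity
  have hkn1 : 100 * (k : ℝ) ≤ n := by nlinarith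
  have hkn2 : 100 * k ≤ n := by exact_mod_cast hkn1
  -- `ballSize k ≤ 5 k²` is at most a tiny multiple of `ε m n`
  have hball : (ballSize k : ℝ) ≤ ε / 10 * (m * n) := by
    have h1 : (ballSize k : ℝ) ≤ 5 * (k * k) := by
      simp only [ballSize]; push_cast; nlinarith
    have h2 : (100 * (k : ℝ)) * (100 * k) ≤ (ε * n) * m :=
      mul_le_mul hkn (by linarith) (by positivity) (by positivity)
    nlinarith
  have hmn : (0 : ℝ) < m * n := mul_pos (by linarith) (by linarith)
  have hN : (ballSize k : ℝ) < m * n := by nlinarith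
  refine ⟨exists_isRelaxedOptimum hα hN, fun q hq => ?_⟩
  obtain ⟨hq1, hq2, hq3⟩ := mem_lowerBoundary.1 hq.1
  have hd1 : 1 ≤ targetSpacing k q := le_min hq2 (by linarith)
  have hd2 : targetSpacing k q ≤ 2 * k + 1 := min_le_right _ _
  have hdq : targetSpacing k q ≤ q.1 / (q.2 - 1) := min_le_left _ _
  have hf : fLB k (targetSpacing k q) = fLB k (q.1 / (q.2 - 1)) := fLB_min _
  obtain ⟨hcov, D, hD0, hfD, hL, hT⟩ := mixedPlan_bounds (n := n) (m := m) hk hd1 hd2 (by omega)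
    hnm (by omega)
  generalize targetSpacing k q = d at *
  obtain ⟨u, v, P, hP1, hP2, hP3⟩ := hcov.exists_walk
  refine ⟨u, v, P, hP1, hP2, fun u' v' Q S hQ => ?_⟩
  refine le_trans ?_ (mul_le_mul_of_nonneg_left (relaxed_le_pathCost hα hβ hq hN hQ)
    (by positivity))
  have hs : 0 < q.2 - 1 := by linarith
  have hP3' : (P.length : ℝ) = routeLen (mixedPlan k n m d).waypoints := by exact_mod_cast hP3
  have hkm : 100 * (k : ℝ) * m ≤ ε * (n * m) := by nlinarith [mul_le_mul_of_nonneg_right hkn hm0]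
  -- the number of points per stop, compared with the relaxed optimum
  have hND : (n * m) * (1 / D) ≤ 11 / 10 * (1 + ε) * (q.2 - 1) := by
    rw [mul_one_div, div_le_iff₀ hD0]
    have h1 : (m : ℝ) * n ≤ (1 + ε) * (m * n - ballSize k) := by nlinarith
    rw [← hq3, ← hf] at h1
    have h2 : (q.2 - 1) * fLB k d ≤ (q.2 - 1) * (11 / 10 * D) :=
      mul_le_mul_of_nonneg_left hfD hs.le
    nlinarith
  have hfac : (1 + 6 * ε) * (11 / 10 * (1 + ε)) ≤ 11 / 10 + 24 * ε := by nlinarith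
  have hND' : (1 + 6 * ε) * ((n * m) * (1 / D)) ≤ (11 / 10 + 24 * ε) * (q.2 - 1) :=
    calc _ ≤ (1 + 6 * ε) * (11 / 10 * (1 + ε) * (q.2 - 1)) :=
          mul_le_mul_of_nonneg_left hND (by positivity)
      _ = (1 + 6 * ε) * (11 / 10 * (1 + ε)) * (q.2 - 1) := by ring
      _ ≤ _ := mul_le_mul_of_nonneg_right hfac hs.le
  have hstops : ((mixedPlan k n m d).stops.card : ℝ) ≤ (11 / 10 + 24 * ε) * (q.2 - 1) := by
    have h1 : (n * m + 198 * k * m : ℝ) ≤ (1 + 6 * ε) * (n * m) := by linarith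
    calc _ ≤ _ := hT
      _ ≤ (1 + 6 * ε) * (n * m) * (1 / D) := mul_le_mul_of_nonneg_right h1 (by positivity)
      _ = (1 + 6 * ε) * ((n * m) * (1 / D)) := by ring
      _ ≤ _ := hND'
  have hlen : (P.length : ℝ) ≤ (11 / 10 + 24 * ε) * q.1 := by
    have h1 : (n * m + 537 * k * m : ℝ) ≤ (1 + 6 * ε) * (n * m) := by linarith
    have h2 : d * (q.2 - 1) ≤ q.1 := (le_div_iff₀ hs).1 hdq
    rw [hP3']
    calc _ ≤ _ := hL
      _ ≤ (1 + 6 * ε) * (n * m) * (d / D) :=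
        mul_le_mul_of_nonneg_right h1 (div_nonneg (by linarith) hD0.le)
      _ = d * ((1 + 6 * ε) * ((n * m) * (1 / D))) := by ring
      _ ≤ d * ((11 / 10 + 24 * ε) * (q.2 - 1)) :=
        mul_le_mul_of_nonneg_left hND' (by linarith)
      _ = (11 / 10 + 24 * ε) * (d * (q.2 - 1)) := by ring
      _ ≤ _ := mul_le_mul_of_nonneg_left h2 (by positivity)
  have h1 := mul_le_mul_of_nonneg_left hlen hα
  have h2 := mul_le_mul_of_nonneg_left hstops hβ
  have h3 : 0 ≤ β * (11 / 10 + 24 * ε) := by positivity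
  rw [pathCost]
  linarith
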